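/- Consider an interface in the plane consisting of finitely many pairwise disjoint edges and a finite set $\mathcal V$ of vertices. Each edge $e$ is a relatively open simple rectifiable arc of length $|e|>0$ with two distinct end points, which belong to $\mathcal V$, and no vertex lies on an open edge. Functions on $e$ are complex-valued, and integrals and the tangential derivative $\partial_e$ are taken with respect to arc length. $H^1(e)$ and $H^2(e)$ are the Sobolev spaces on $e$, and $H^1_0(e)$ is the subspace of $H^1(e)$ of functions with zero trace at both end points. $H^{1/2}(e)$ is the interpolation space halfway between $L^2(e)$ and $H^1(e)$, and $H^{3/2}(e)$ is the one halfway between $H^1(e)$ and $H^2(e)$, with norms $\big(\int_0^\infty t^{-1}K(t,f)^2\,\frac{dt}{t}\big)^{1/2}$, where $K(t,f)=\inf\{\|f_0\|_{X}+t\|f_1\|_{Y}: f=f_0+f_1\}$ for the respective pair $(X,Y)=(L^2(e),H^1(e))$ or $(H^1(e),H^2(e))$. For $p\in\mathcal V$ let $\varphi_p$ be the real function on the interface which is continuous on each closed edge, harmonic along each edge (vanishing second arc-length derivative), and satisfies $\varphi_p(q)=\delta_{p,q}$ for all $q\in\mathcal V$; the nodal interpolant is $I_{\mathcal V}w=\sum_{p\in\mathcal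 V}w(p)\varphi_p$. Let $(\tau_i^e,\lambda_i^e)_{i\ge1}$, with $\tau^e_i\in H^1_0(e)$ and $\lambda^e_i\in\mathbb R$, be the edge modes, that is, an enumeration, ordered by non-decreasing eigenvalue and orthonormal in $L^2(e)$, of solutions of $$(\partial_e\tau_i^e,\partial_e\eta)_{L^2(e)}=\lambda_i^e(\tau_i^e,\eta)_{L^2(e)}\qquad\text{for all }\eta\in H_0^1(e),$$ which exhausts all eigenspaces, and put $V^e_{I}=\operatorname{span}\{\tau^e_1,\dots,\tau^e_{I}\}$. **Lemma.** For every edge $e$ there is a constant $C>0$, independent of $I_e$ and $w$, such that every $w\in H^{3/2}(e)$ has a representative which is continuous on $\overline e$ (so that $I_{\mathcal V}w$ is well defined on $e$) and, for this representative and every integer $I_e\ge1$, $$\inf_{v^e\in V^e_{I_e}}\|w-I_{\mathcal V}w-v^e\|_{H^{1/2}(e)}\le \frac{C}{\sqrt{\lambda^e_{I_e}}}\,\|w\|_{H^{3/2}(e)} .$$ -/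

import Mathlib

open Set MeasureTheory
open scoped ENNReal

noncomputable section

/-! ### Sobolev and interpolation norms on the interval `(0, L)`

Functions are considered up to equality almost everywhere. The norms take values in `[0, ∞]`;
a function belongs to a space when its norm is finite. -/

/-- Lebesgue measure on the open interval `(0, L)`. -/
def intervalMeasure (L : ℝ) : Measure ℝ := volume.restrict (Ioo 0 L)

/-- `g` is the weak derivative of `f` on `(0, L)`. -/
def IsWeakDeriv (L : ℝ) (f g : ℝ → ℂ) : Prop :=
  ∀ ψ : ℝ → ℝ, ContDiff ℝ (⊤ : ℕ∞) ψ → HasCompactSupport ψ → tsupport ψ ⊆ Ioo 0 L →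
    ∫ s in Ioo 0 L, deriv ψ s • f s = - ∫ s in Ioo 0 L, ψ s • g s

/-- `g 0 = f, g 1, …, g k` are the weak derivatives of `f` up to order `k`, all of them square
integrable on `(0, L)`. -/
def IsWeakDerivChain (L : ℝ) (k : ℕ) (f : ℝ → ℂ) (g : ℕ → ℝ → ℂ) : Prop :=
  g 0 = f ∧ (∀ i ≤ k, MemLp (g i) 2 (intervalMeasure L)) ∧
    ∀ i < k, IsWeakDeriv L (g i) (g (i + 1))

/-- The norm of `H^k(0, L)`, i.e. `(∑_{i ≤ k} ‖f^(i)‖²)^{1/2}`; it is `∞` outside `H^k(0, L)`.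
For `k = 0` this is the norm of `L²(0, L)`. (Weak derivatives are unique almost everywhere, so the
infimum is over equal values.) -/
def sobolevNorm (L : ℝ) (k : ℕ) (f : ℝ → ℂ) : ℝ≥0∞ :=
  ⨅ (g : ℕ → ℝ → ℂ) (_ : IsWeakDerivChain L k f g),
    (∑ i ∈ Finset.range (k + 1), eLpNorm (g i) 2 (intervalMeasure L) ^ 2) ^ (1 / 2 : ℝ)

/-- The `K`-functional `K(t, f) = inf { N₀ f₀ + t N₁ f₁ : f = f₀ + f₁ }` of a pair of norms. -/
def kFunctional (N₀ N₁ : (ℝ → ℂ) → ℝ≥0∞) (t : ℝ) (f : ℝ → ℂ) : ℝ≥0∞ :=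
  ⨅ f₁ : ℝ → ℂ, N₀ (f - f₁) + ENNReal.ofReal t * N₁ f₁

/-- The norm of the interpolation space halfway between the spaces normed by `N₀` and `N₁`:
`(∫_0^∞ (t^{-1/2} K(t, f))² dt/t)^{1/2}`. -/
def halfwayNorm (N₀ N₁ : (ℝ → ℂ) → ℝ≥0∞) (f : ℝ → ℂ) : ℝ≥0∞ :=
  (∫⁻ t in Ioi (0 : ℝ),
    (ENNReal.ofReal (t ^ (-(1 / 2) : ℝ)) * kFunctional N₀ N₁ t f) ^ 2 * ENNReal.ofReal t⁻¹)
      ^ (1 / 2 : ℝ)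

/-- `f ∈ H^1_0(0, L)`: `f ∈ H^1(0, L)` has vanishing trace, i.e. its continuous representative
vanishes at both end points. -/
def MemH10 (L : ℝ) (f : ℝ → ℂ) : Prop :=
  sobolevNorm L 1 f < ⊤ ∧
    ∃ h : ℝ → ℂ, ContinuousOn h (Icc 0 L) ∧ h =ᵐ[intervalMeasure L] f ∧ h 0 = 0 ∧ h L = 0

/-! ### Edges and the interface -/

/-- The Euclidean plane. -/
abbrev EuclideanPlane : Type := EuclideanSpace ℝ (Fin 2)

/-- An edge: an open simple rectifiable arc in the plane with two distinct end points, given by its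
parametrization by arc length `[0, length] → ℝ²`. Functions on the edge are functions on the plane
of which only the values on the closed arc matter; they are integrated and differentiated with
respect to arc length, i.e. after composition with `param`. -/
structure InterfaceEdge where
  length : ℝ
  length_pos : 0 < length
  param : ℝ → EuclideanPlane
  injOn : InjOn param (Icc 0 length)
  unitSpeed : HasUnitSpeedOn param (Icc 0 length)

namespace InterfaceEdge

variable (e : InterfaceEdge)

/-- The edge as a relatively open arc, without its end points. -/
def carrier : Set EuclideanPlane := e.param '' Ioo 0 e.length

/-- Equality almost everywhere on the edge. -/
def AEEqual (u w : EuclideanPlane → ℂ) : Prop :=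
  u ∘ e.param =ᵐ[intervalMeasure e.length] w ∘ e.param

/-- Continuity on the closed edge. -/
def ContinuousOnClosure (w : EuclideanPlane → ℂ) : Prop :=
  ContinuousOn (w ∘ e.param) (Icc 0 e.length)

/-- The norm of `H^{1/2}(e)`, the interpolation space between `L²(e)` and `H^1(e)`. -/
def normHHalf (u : EuclideanPlane → ℂ) : ℝ≥0∞ :=
  halfwayNorm (sobolevNorm e.length 0) (sobolevNorm e.length 1) (u ∘ e.param)

/-- The norm of `H^{3/2}(e)`, the interpolation space between `H^1(e)` and `H²(e)`. -/
def normHThreeHalves (u : EuclideanPlane → ℂ) : ℝ≥0∞ :=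
  halfwayNorm (sobolevNorm e.length 1) (sobolevNorm e.length 2) (u ∘ e.param)

/-- `τ ∈ H^1_0(e)` and `(∂_e τ, ∂_e η)_e = μ (τ, η)_e` for all `η ∈ H^1_0(e)`. -/
def IsEigenpair (τ : EuclideanPlane → ℂ) (μ : ℝ) : Prop :=
  MemH10 e.length (τ ∘ e.param) ∧
    ∀ η : ℝ → ℂ, MemH10 e.length η → ∀ dτ dη : ℝ → ℂ,
      MemLp dτ 2 (intervalMeasure e.length) → IsWeakDeriv e.length (τ ∘ e.param) dτ →
      MemLp dη 2 (intervalMeasure e.length) → IsWeakDeriv e.length η dη →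
        ∫ s in Ioo 0 e.length, dτ s * starRingEnd ℂ (dη s) =
          (μ : ℂ) * ∫ s in Ioo 0 e.length, τ (e.param s) * starRingEnd ℂ (η s)

/-- `(τ i, ev i)`, `i = 1, 2, …`, is an enumeration of the edge modes: eigenpairs that are
orthonormal in `L²(e)`, ordered by non-decreasing eigenvalue, and exhaust all eigenspaces. The
entries with index `0` are not used. -/
structure IsEdgeModes (τ : ℕ → EuclideanPlane → ℂ) (ev : ℕ → ℝ) : Prop where
  eigenpair : ∀ i, 1 ≤ i → e.IsEigenpair (τ i) (ev i)
  orthonormal : ∀ i j, 1 ≤ i → 1 ≤ j →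
    ∫ s in Ioo 0 e.length, τ i (e.param s) * starRingEnd ℂ (τ j (e.param s)) =
      if i = j then 1 else 0
  monotone : ∀ i j, 1 ≤ i → i ≤ j → ev i ≤ ev j
  exhaustive : ∀ (σ : EuclideanPlane → ℂ) (μ : ℝ), e.IsEigenpair σ μ →
    ∃ v ∈ Submodule.span ℂ (τ '' {i | 1 ≤ i ∧ ev i = μ}), e.AEEqual v σ

end InterfaceEdge

/-- The space spanned by the first `n` modes `τ 1, …, τ n`. -/
def modeSpace (τ : ℕ → EuclideanPlane → ℂ) (n : ℕ) : Submodule ℂ (EuclideanPlane → ℂ) :=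
  Submodule.span ℂ (τ '' Icc 1 n)

/-- The edges and vertices of a domain decomposition interface: finitely many pairwise disjoint open
edges, and finitely many points, the vertices, which lie on no (open) edge and include the end
points of all edges. -/
structure DecompositionInterface where
  numEdges : ℕ
  edge : Fin numEdges → InterfaceEdge
  vertices : Finset EuclideanPlane
  start_mem : ∀ k, (edge k).param 0 ∈ vertices
  end_mem : ∀ k, (edge k).param (edge k).length ∈ vertices
  vertex_notMem : ∀ p ∈ vertices, ∀ k, p ∉ (edge k).carrier
  disjoint : ∀ k l, k ≠ l → Disjoint (edge k).carrier (edge l).carrier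

namespace DecompositionInterface

variable (N : DecompositionInterface)

/-- `φ p`, `p` a vertex, are the vertex functions: `φ p` is harmonic along each edge, continuous up
to its end points, and `φ p q = δ_{p q}` for all vertices `q`. -/
structure IsVertexBasis (φ : EuclideanPlane → EuclideanPlane → ℝ) : Prop where
  nodal : ∀ p ∈ N.vertices, ∀ q ∈ N.vertices, φ p q = if p = q then 1 else 0
  continuousOn : ∀ p ∈ N.vertices, ∀ k,
    ContinuousOn (φ p ∘ (N.edge k).param) (Icc 0 (N.edge k).length)
  harmonic : ∀ p ∈ N.vertices, ∀ k,
    InnerProductSpace.HarmonicOnNhd (φ p ∘ (N.edge k).param) (Ioo 0 (N.edge k).length)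

/-- The nodal interpolant `∑_p w(p) φ_p`, the sum being over all vertices. -/
def nodalInterpolant (φ : EuclideanPlane → EuclideanPlane → ℝ) (w : EuclideanPlane → ℂ) :
    EuclideanPlane → ℂ :=
  fun x => ∑ p ∈ N.vertices, w p * (φ p x : ℂ)

end DecompositionInterface

end

/-! On an edge the nodal interpolant is the affine function with the end values of `w`. Let `R_n w`
be what is left of `w` after subtracting this affine function and then the `L²` projection of the
difference onto the first `n` modes. The infimum is bounded by taking that projection as competitor,
so it suffices to estimate `R_n`, a linear operator on continuous functions.

The difference `V` of `w` and its affine interpolant vanishes at the ends. The modes are an `L²`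
orthonormal basis and their derivatives are orthogonal with squared norms `λ_i`, so Parseval and
Bessel give `√λ_n ‖R_n w‖ ≤ ‖(R_n w)'‖ ≤ ‖V'‖ ≤ ‖w'‖`. If `w''` is in `L²`, integration by parts
gives `‖(R_n w)'‖² ≤ ‖R_n w‖ ‖w''‖`, hence `√λ_n ‖(R_n w)'‖ ≤ ‖w''‖`. This is
`norm_modeRemainder_le`, made concrete in `exists_modeResidual_deriv`.

Thus `R_n` maps `H¹` to `L²` and `H²` to `H¹`, both with norm at most `λ_n^{-1/2}`. Applying it to
both parts of a splitting of `w` compares the K-functionals (`mul_kFunctional_le`), and the lemma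
follows with `C = 1`. Completeness of the modes rests on the sines: they are eigenfunctions, hence
spanned by modes, and they are complete by Fourier series. -/

/-! ### Primitives and integration by parts -/

/-- `F` is a primitive on `[0, L]` of the integrable function `f`. -/
def IsPrimitive (L : ℝ) (F f : ℝ → ℂ) : Prop :=
  IntegrableOn f (Ioo 0 L) ∧ ∀ x ∈ Icc 0 L, F x = F 0 + ∫ t in (0 : ℝ)..x, f t

theorem IsPrimitive.intervalIntegrable {L : ℝ} {F f : ℝ → ℂ} (h : IsPrimitive L F f) {x : ℝ}
    (hx : x ∈ Icc 0 L) : IntervalIntegrable f volume 0 x := by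
  rw [intervalIntegrable_iff_integrableOn_Ioo_of_le hx.1]
  exact h.1.mono_set (Ioo_subset_Ioo_right hx.2)

theorem continuousOn_primitive_of_integrableOn_Ioo {L : ℝ} (hL : 0 < L) {f : ℝ → ℂ}
    (h : IntegrableOn f (Ioo 0 L)) : ContinuousOn (fun x => ∫ t in (0 : ℝ)..x, f t) (Icc 0 L) := by
  have := intervalIntegral.continuousOn_primitive_interval (f := f) (a := 0) (b := L) (μ := volume)
    (by rw [uIcc_of_le hL.le, integrableOn_Icc_iff_integrableOn_Ioo]; exact h)
  rwa [uIcc_of_le hL.le] at this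

theorem IsPrimitive.continuousOn {L : ℝ} (hL : 0 < L) {F f : ℝ → ℂ} (h : IsPrimitive L F f) :
    ContinuousOn F (Icc 0 L) :=
  (continuousOn_const.add (continuousOn_primitive_of_integrableOn_Ioo hL h.1)).congr h.2

theorem IsPrimitive.integrableOn {L : ℝ} (hL : 0 < L) {F f : ℝ → ℂ} (h : IsPrimitive L F f) :
    IntegrableOn F (Ioo 0 L) :=
  (h.continuousOn hL).integrableOn_Icc.mono_set Ioo_subset_Icc_self

/-- Fubini's theorem on the two triangles that make up the square `(0, L) × (0, L)`. -/
theorem integral_primitive_mul_add {L : ℝ} {f g : ℝ → ℂ}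
    (hf : IntegrableOn f (Ioo 0 L)) (hg : IntegrableOn g (Ioo 0 L)) :
    (∫ x in Ioo 0 L, (∫ t in (0 : ℝ)..x, f t) * g x) + ∫ x in Ioo 0 L, f x * ∫ t in (0 : ℝ)..x, g t =
      (∫ x in Ioo 0 L, f x) * ∫ x in Ioo 0 L, g x := by
  set μ := volume.restrict (Ioo 0 L)
  have hprod : Integrable (fun z : ℝ × ℝ => f z.2 * g z.1) (μ.prod μ) :=
    (hg.mul_prod hf).congr (ae_of_all _ fun z => mul_comm _ _)
  have hset : MeasurableSet {z : ℝ × ℝ | z.2 ≤ z.1} := measurableSet_le measurable_snd measurable_fst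
  have hprim : ∀ h : ℝ → ℂ, ∀ x ∈ Ioo 0 L,
      ∫ t in (0 : ℝ)..x, h t = ∫ t, (Iic x).indicator h t ∂μ := by
    intro h x hx
    rw [integral_indicator measurableSet_Iic, intervalIntegral.integral_of_le hx.1.le,
      Measure.restrict_restrict measurableSet_Iic]
    congr 2
    ext t
    simp only [mem_Ioc, mem_inter_iff, mem_Iic, mem_Ioo]
    exact ⟨fun h => ⟨h.2, h.1, h.2.trans_lt hx.2⟩, fun h => ⟨h.2.1, h.1⟩⟩
  -- Dropping the null set `{x}` makes the second triangle exactly the complement of the first.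
  have hprim' : ∀ h : ℝ → ℂ, ∀ x ∈ Ioo 0 L,
      ∫ t in (0 : ℝ)..x, h t = ∫ t, (Iio x).indicator h t ∂μ := by
    intro h x hx
    rw [hprim h x hx, integral_indicator measurableSet_Iic, integral_indicator measurableSet_Iio]
    congr 1
    exact (Measure.restrict_congr_set
      (Iio_ae_eq_Iic' (measure_mono_null (t := {x}) subset_rfl (by simp [μ])))).symm
  have h1 : ∫ x, (∫ t in (0 : ℝ)..x, f t) * g x ∂μ =
      ∫ z, {z : ℝ × ℝ | z.2 ≤ z.1}.indicator (fun z => f z.2 * g z.1) z ∂(μ.prod μ) := by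
    rw [integral_prod _ (hprod.indicator hset)]
    refine setIntegral_congr_fun measurableSet_Ioo fun x hx => ?_
    rw [hprim f x hx, ← integral_mul_const]
    refine integral_congr_ae (ae_of_all _ fun t => ?_)
    by_cases h : t ≤ x <;> simp [indicator, h]
  have h2 : ∫ x, f x * (∫ t in (0 : ℝ)..x, g t) ∂μ =
      ∫ z, {z : ℝ × ℝ | z.2 ≤ z.1}ᶜ.indicator (fun z => f z.2 * g z.1) z ∂(μ.prod μ) := by
    rw [integral_prod_symm _ (hprod.indicator hset.compl)]
    refine setIntegral_congr_fun measurableSet_Ioo fun x hx => ?_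
    rw [hprim' g x hx, ← integral_const_mul]
    refine integral_congr_ae (ae_of_all _ fun t => ?_)
    by_cases h : t < x <;> simp [indicator, h]
  rw [h1, h2, ← integral_add (hprod.indicator hset) (hprod.indicator hset.compl)]
  have : ∀ z : ℝ × ℝ, {z : ℝ × ℝ | z.2 ≤ z.1}.indicator (fun z => f z.2 * g z.1) z +
      {z : ℝ × ℝ | z.2 ≤ z.1}ᶜ.indicator (fun z => f z.2 * g z.1) z = g z.1 * f z.2 := by
    intro z
    rw [indicator_self_add_compl_apply, mul_comm]
  simp_rw [this]
  rw [integral_prod_mul, mul_comm]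

theorem integrableOn_primitive_mul {L : ℝ} (hL : 0 < L) {F f g : ℝ → ℂ} (hF : IsPrimitive L F f)
    (hg : IntegrableOn g (Ioo 0 L)) : IntegrableOn (fun x => F x * g x) (Ioo 0 L) := by
  have hg' : IntegrableOn g (Icc 0 L) := by rwa [integrableOn_Icc_iff_integrableOn_Ioo]
  exact (hg'.continuousOn_mul (hF.continuousOn hL) isCompact_Icc).mono_set Ioo_subset_Icc_self

/-- Integration by parts. -/
theorem IsPrimitive.integral_mul_add_integral_mul {L : ℝ} (hL : 0 < L) {F f G g : ℝ → ℂ}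
    (hF : IsPrimitive L F f) (hG : IsPrimitive L G g) :
    (∫ x in Ioo 0 L, F x * g x) + ∫ x in Ioo 0 L, f x * G x = F L * G L - F 0 * G 0 := by
  have hf0 : IsPrimitive L (fun x => ∫ t in (0 : ℝ)..x, f t) f := ⟨hF.1, by simp⟩
  have hg0 : IsPrimitive L (fun x => ∫ t in (0 : ℝ)..x, g t) g := ⟨hG.1, by simp⟩
  have key := integral_primitive_mul_add hF.1 hG.1
  have e1 : ∫ x in Ioo 0 L, F x * g x =
      F 0 * (∫ x in Ioo 0 L, g x) + ∫ x in Ioo 0 L, (∫ t in (0 : ℝ)..x, f t) * g x := by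
    rw [← integral_const_mul, ← integral_add (hG.1.const_mul _)
      (integrableOn_primitive_mul hL hf0 hG.1)]
    refine setIntegral_congr_fun measurableSet_Ioo fun x hx => ?_
    simp only [hF.2 x (Ioo_subset_Icc_self hx)]
    ring
  have e2 : ∫ x in Ioo 0 L, f x * G x =
      G 0 * (∫ x in Ioo 0 L, f x) + ∫ x in Ioo 0 L, f x * ∫ t in (0 : ℝ)..x, g t := by
    have := integrableOn_primitive_mul hL hg0 hF.1
    rw [← integral_const_mul, ← integral_add (hF.1.const_mul _)
      (this.congr (ae_of_all _ fun x => mul_comm _ _))]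
    refine setIntegral_congr_fun measurableSet_Ioo fun x hx => ?_
    simp only [hG.2 x (Ioo_subset_Icc_self hx)]
    ring
  have hFL := hF.2 L (right_mem_Icc.2 hL.le)
  have hGL := hG.2 L (right_mem_Icc.2 hL.le)
  rw [intervalIntegral.integral_of_le hL.le, integral_Ioc_eq_integral_Ioo] at hFL hGL
  rw [e1, e2, hFL, hGL]
  linear_combination key

theorem isPrimitive_of_hasDerivAt {L : ℝ} {F f : ℝ → ℂ} (h : ∀ x, HasDerivAt F (f x) x)
    (hf : Continuous f) : IsPrimitive L F f := by
  refine ⟨hf.integrableOn_Icc.mono_set Ioo_subset_Icc_self, fun x _ => ?_⟩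
  rw [intervalIntegral.integral_eq_sub_of_hasDerivAt (fun y _ => h y) (hf.intervalIntegrable _ _)]
  ring

/-! ### Test functions and weak derivatives -/

theorem notMem_tsupport_ends {L : ℝ} {ψ : ℝ → ℝ} (h : tsupport ψ ⊆ Ioo 0 L) : ψ 0 = 0 ∧ ψ L = 0 :=
  ⟨image_eq_zero_of_notMem_tsupport fun h0 => (lt_irrefl _ (h h0).1),
    image_eq_zero_of_notMem_tsupport fun h0 => (lt_irrefl _ (h h0).2)⟩

theorem isPrimitive_ofReal {L : ℝ} {ψ : ℝ → ℝ} (hψ : ContDiff ℝ (⊤ : ℕ∞) ψ) :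
    IsPrimitive L (fun x => (ψ x : ℂ)) (fun x => ((deriv ψ x : ℝ) : ℂ)) :=
  isPrimitive_of_hasDerivAt
    (fun x => ((hψ.differentiable (by simp)).differentiableAt.hasDerivAt).ofReal_comp)
    (Complex.continuous_ofReal.comp (hψ.continuous_deriv (by simp)))

theorem IsPrimitive.isWeakDeriv {L : ℝ} (hL : 0 < L) {F f : ℝ → ℂ} (h : IsPrimitive L F f) :
    IsWeakDeriv L F f := by
  intro ψ hψ _ hs
  have := (isPrimitive_ofReal (L := L) hψ).integral_mul_add_integral_mul hL h
  obtain ⟨h0, h1⟩ := notMem_tsupport_ends hs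
  simp only [h0, h1, Complex.ofReal_zero, zero_mul, sub_zero] at this
  simp only [Complex.real_smul]
  exact eq_neg_of_add_eq_zero_right this

theorem IsWeakDeriv.congr {L : ℝ} {f f' g g' : ℝ → ℂ} (h : IsWeakDeriv L f g)
    (hf : f =ᵐ[intervalMeasure L] f') (hg : g =ᵐ[intervalMeasure L] g') : IsWeakDeriv L f' g' := by
  intro ψ h1 h2 h3
  have e1 : ∫ s in Ioo 0 L, deriv ψ s • f' s = ∫ s in Ioo 0 L, deriv ψ s • f s :=
    integral_congr_ae (hf.symm.mono fun x hx => by simp only [hx])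
  have e2 : ∫ s in Ioo 0 L, ψ s • g' s = ∫ s in Ioo 0 L, ψ s • g s :=
    integral_congr_ae (hg.symm.mono fun x hx => by simp only [hx])
  rw [e1, e2]
  exact h ψ h1 h2 h3

theorem integrableOn_smul_of_continuous {L : ℝ} {ψ : ℝ → ℝ} (hψ : Continuous ψ) {f : ℝ → ℂ}
    (hf : IntegrableOn f (Ioo 0 L)) : IntegrableOn (fun s => ψ s • f s) (Ioo 0 L) := by
  rw [← integrableOn_Icc_iff_integrableOn_Ioo] at hf ⊢
  exact hf.continuousOn_smul hψ.continuousOn isCompact_Icc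

theorem IsWeakDeriv.sub {L : ℝ} {f f' g g' : ℝ → ℂ} (h : IsWeakDeriv L f g)
    (h' : IsWeakDeriv L f' g') (hf : IntegrableOn f (Ioo 0 L)) (hf' : IntegrableOn f' (Ioo 0 L))
    (hg : IntegrableOn g (Ioo 0 L)) (hg' : IntegrableOn g' (Ioo 0 L)) :
    IsWeakDeriv L (fun x => f x - f' x) (fun x => g x - g' x) := by
  intro ψ h1 h2 h3
  have c1 := h1.continuous
  have c2 : Continuous (deriv ψ) := h1.continuous_deriv (by simp)
  simp only [smul_sub]
  rw [integral_sub (integrableOn_smul_of_continuous c2 hf) (integrableOn_smul_of_continuous c2 hf'),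
    integral_sub (integrableOn_smul_of_continuous c1 hg) (integrableOn_smul_of_continuous c1 hg'),
    h ψ h1 h2 h3, h' ψ h1 h2 h3]
  ring

theorem IsWeakDeriv.sum_const_mul {L : ℝ} (s : Finset ℕ) (c : ℕ → ℂ) {f g : ℕ → ℝ → ℂ}
    (h : ∀ i ∈ s, IsWeakDeriv L (f i) (g i)) (hf : ∀ i ∈ s, IntegrableOn (f i) (Ioo 0 L))
    (hg : ∀ i ∈ s, IntegrableOn (g i) (Ioo 0 L)) :
    IsWeakDeriv L (fun x => ∑ i ∈ s, c i * f i x) (fun x => ∑ i ∈ s, c i * g i x) := by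
  intro ψ h1 h2 h3
  have c1 := h1.continuous
  have c2 : Continuous (deriv ψ) := h1.continuous_deriv (by simp)
  simp only [Finset.smul_sum]
  rw [integral_finsetSum _ fun i hi =>
      integrableOn_smul_of_continuous c2 ((hf i hi).const_mul (c i)),
    integral_finsetSum _ fun i hi =>
      integrableOn_smul_of_continuous c1 ((hg i hi).const_mul (c i)), ← Finset.sum_neg_distrib]
  refine Finset.sum_congr rfl fun i hi => ?_
  have e : ∀ (r : ℝ) (z : ℂ), r • (c i * z) = c i * r • z := fun r z =>
    (mul_smul_comm _ _ _).symm
  simp only [e]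
  rw [integral_const_mul, integral_const_mul, h i hi ψ h1 h2 h3, mul_neg]

theorem ae_eq_zero_of_forall_integral_smul_eq_zero {L : ℝ} {f : ℝ → ℂ}
    (hf : IntegrableOn f (Ioo 0 L))
    (h : ∀ ψ : ℝ → ℝ, ContDiff ℝ (⊤ : ℕ∞) ψ → HasCompactSupport ψ → tsupport ψ ⊆ Ioo 0 L →
      ∫ s in Ioo 0 L, ψ s • f s = 0) : f =ᵐ[intervalMeasure L] 0 := by
  have := isOpen_Ioo.ae_eq_zero_of_integral_contDiff_smul_eq_zero (U := Ioo 0 L)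
    hf.locallyIntegrableOn (fun ψ h1 h2 h3 => by
      rw [← h ψ h1 h2 h3]
      refine (setIntegral_eq_integral_of_forall_compl_eq_zero fun x hx => ?_).symm
      rw [image_eq_zero_of_notMem_tsupport fun h' => hx (h3 h'), zero_smul])
  rw [intervalMeasure, Filter.EventuallyEq, ae_restrict_iff' measurableSet_Ioo]
  exact this

theorem IsWeakDeriv.unique {L : ℝ} {f g g' : ℝ → ℂ} (h : IsWeakDeriv L f g)
    (h' : IsWeakDeriv L f g') (hg : IntegrableOn g (Ioo 0 L)) (hg' : IntegrableOn g' (Ioo 0 L)) :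
    g =ᵐ[intervalMeasure L] g' := by
  have := ae_eq_zero_of_forall_integral_smul_eq_zero (hg.sub hg') (fun ψ h1 h2 h3 => by
    simp only [Pi.sub_apply, smul_sub]
    rw [integral_sub (integrableOn_smul_of_continuous h1.continuous hg)
      (integrableOn_smul_of_continuous h1.continuous hg')]
    linear_combination h ψ h1 h2 h3 - h' ψ h1 h2 h3)
  exact this.mono fun x hx => by simpa [sub_eq_zero] using hx

/-- A test function of mean zero has a test function as primitive. -/
theorem exists_testFunction_deriv_eq {L : ℝ} (hL : 0 < L) {θ : ℝ → ℝ}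
    (h1 : ContDiff ℝ (⊤ : ℕ∞) θ) (h2 : HasCompactSupport θ) (h3 : tsupport θ ⊆ Ioo 0 L)
    (h4 : ∫ s in Ioo 0 L, θ s = 0) :
    ∃ ψ : ℝ → ℝ, ContDiff ℝ (⊤ : ℕ∞) ψ ∧ HasCompactSupport ψ ∧ tsupport ψ ⊆ Ioo 0 L ∧
      deriv ψ = θ := by
  obtain ⟨a, b, ha, hb, hab⟩ : ∃ a b, 0 < a ∧ b < L ∧ tsupport θ ⊆ Icc a b := by
    rcases (tsupport θ).eq_empty_or_nonempty with h | h
    · exact ⟨L / 2, L / 2, by linarith, by linarith, by simp [h]⟩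
    · exact ⟨sInf (tsupport θ), sSup (tsupport θ), (h3 (h2.sInf_mem h)).1, (h3 (h2.sSup_mem h)).2,
        fun x hx => ⟨csInf_le h2.bddBelow hx, le_csSup h2.bddAbove hx⟩⟩
  have hz : ∀ x, x ∉ Icc a b → θ x = 0 := fun x hx =>
    image_eq_zero_of_notMem_tsupport fun h => hx (hab h)
  have hd : deriv (fun x => ∫ t in (0 : ℝ)..x, θ t) = θ := by
    ext x
    exact (h1.continuous.integral_hasStrictDerivAt 0 x).hasDerivAt.deriv
  have hsupp : tsupport (fun x => ∫ t in (0 : ℝ)..x, θ t) ⊆ Icc a b := by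
    refine closure_minimal (fun x hx => ?_) isClosed_Icc
    by_contra hxab
    refine hx ?_
    -- Left of `a` the integrand vanishes; right of `b` the integral is already the whole mean,
    -- which is zero.
    rcases lt_or_ge x a with h | h
    · refine intervalIntegral.integral_zero_ae (ae_of_all _ fun t ht => hz t fun h' => ?_)
      have h5 : t ≤ max 0 x := (uIoc_subset_uIcc ht).2
      have h6 : max 0 x < a := max_lt ha h
      linarith [h'.1]
    · have hxb : b < x := by
        by_contra h'
        exact hxab ⟨h, not_lt.1 h'⟩
      have e : ∫ t in x..L, θ t = 0 := by
        refine intervalIntegral.integral_zero_ae (ae_of_all _ fun t ht => hz t fun h' => ?_)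
        have := (uIoc_subset_uIcc ht).1
        have h6 : b < min x L := lt_min hxb hb
        linarith [h'.2]
      have := intervalIntegral.integral_add_adjacent_intervals
        (h1.continuous.intervalIntegrable 0 x (μ := volume)) (h1.continuous.intervalIntegrable x L)
      rw [e, add_zero, intervalIntegral.integral_of_le hL.le, integral_Ioc_eq_integral_Ioo, h4] at this
      exact this
  refine ⟨fun x => ∫ t in (0 : ℝ)..x, θ t, ?_, ?_, ?_, hd⟩
  · rw [contDiff_infty_iff_deriv, hd]
    exact ⟨fun x => (h1.continuous.integral_hasStrictDerivAt 0 x).hasDerivAt.differentiableAt, h1⟩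
  · exact isCompact_Icc.of_isClosed_subset (isClosed_tsupport _) hsupp
  · exact hsupp.trans fun x hx => ⟨ha.trans_le hx.1, hx.2.trans_lt hb⟩

/-- The lemma of du Bois-Reymond. -/
theorem IsWeakDeriv.ae_eq_const {L : ℝ} (hL : 0 < L) {f : ℝ → ℂ} (h : IsWeakDeriv L f 0)
    (hf : IntegrableOn f (Ioo 0 L)) : ∃ c : ℂ, f =ᵐ[intervalMeasure L] fun _ => c := by
  -- A test function `χ` of integral one. For any test function `φ` with integral `m`, the function
  -- `φ - m χ` is the derivative of a test function, which identifies the constant as `∫ χ f`.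
  let B : ContDiffBump (L / 2) := ⟨L / 8, L / 4, by linarith, by linarith⟩
  set χ : ℝ → ℝ := B.normed volume with hχ
  have c1 : ContDiff ℝ (⊤ : ℕ∞) χ := B.contDiff_normed
  have c2 : HasCompactSupport χ := B.hasCompactSupport_normed
  have c3 : tsupport χ ⊆ Ioo 0 L := by
    rw [hχ, B.tsupport_normed_eq, Real.closedBall_eq_Icc]
    intro x hx
    simp only [mem_Icc, B] at hx
    exact ⟨by linarith [hx.1], by linarith [hx.2]⟩
  have c4 : ∫ s in Ioo 0 L, χ s = 1 := by
    rw [← B.integral_normed (μ := volume)]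
    refine setIntegral_eq_integral_of_forall_compl_eq_zero fun x hx => ?_
    exact image_eq_zero_of_notMem_tsupport fun h' => hx (c3 h')
  set c := ∫ s in Ioo 0 L, χ s • f s with hc
  refine ⟨c, ?_⟩
  have hconst : IntegrableOn (fun _ : ℝ => c) (Ioo 0 L) := by simp
  have := ae_eq_zero_of_forall_integral_smul_eq_zero (hf.sub hconst) (fun φ h1 h2 h3 => by
    have hφi : IntegrableOn φ (Ioo 0 L) :=
      h1.continuous.integrableOn_Icc.mono_set Ioo_subset_Icc_self
    have hχi : IntegrableOn χ (Ioo 0 L) :=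
      c1.continuous.integrableOn_Icc.mono_set Ioo_subset_Icc_self
    set m := ∫ s in Ioo 0 L, φ s with hm
    obtain ⟨ψ, p1, p2, p3, p4⟩ := exists_testFunction_deriv_eq hL (θ := fun x => φ x - m * χ x)
      (h1.sub (contDiff_const.mul c1)) (h2.sub (c2.mul_left (f := fun _ => m)))
      ((tsupport_sub φ (fun x => m * χ x)).trans (union_subset h3
        ((tsupport_mul_subset_right (f := fun _ => m)).trans c3)))
      (by rw [integral_sub hφi (hχi.const_mul m), integral_const_mul, c4, mul_one, sub_self])
    have key := h ψ p1 p2 p3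
    rw [p4] at key
    simp only [sub_smul, mul_smul, Pi.zero_apply, smul_zero, integral_zero, neg_zero] at key
    have hi : IntegrableOn (fun s => m • χ s • f s) (Ioo 0 L) :=
      (integrableOn_smul_of_continuous c1.continuous hf).smul m
    rw [integral_sub (integrableOn_smul_of_continuous h1.continuous hf) hi, integral_smul,
      ← hc] at key
    simp only [Pi.sub_apply, smul_sub]
    rw [integral_sub (integrableOn_smul_of_continuous h1.continuous hf)
      (integrableOn_smul_of_continuous h1.continuous hconst), integral_smul_const, ← hm]
    exact key)
  exact this.mono fun x hx => by simpa [sub_eq_zero] using hx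

/-- Subtracting `∫ g` from `f` leaves a function with weak derivative zero, which is constant by du
Bois-Reymond. -/
theorem IsWeakDeriv.exists_isPrimitive {L : ℝ} (hL : 0 < L) {f g : ℝ → ℂ} (h : IsWeakDeriv L f g)
    (hf : IntegrableOn f (Ioo 0 L)) (hg : IntegrableOn g (Ioo 0 L)) :
    ∃ F, IsPrimitive L F g ∧ F =ᵐ[intervalMeasure L] f := by
  have hG : IsPrimitive L (fun x => ∫ t in (0 : ℝ)..x, g t) g := ⟨hg, by simp⟩
  have h0 := h.sub (hG.isWeakDeriv hL) hf (hG.integrableOn hL) hg hg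
  simp only [sub_self] at h0
  obtain ⟨c, hc⟩ := IsWeakDeriv.ae_eq_const hL h0 (hf.sub (hG.integrableOn hL))
  refine ⟨fun x => c + ∫ t in (0 : ℝ)..x, g t, ⟨hg, by simp⟩, ?_⟩
  filter_upwards [hc] with x hx
  rw [← hx]
  ring

theorem eqOn_Icc_of_ae_eq_intervalMeasure {L : ℝ} (hL : 0 < L) {f g : ℝ → ℂ}
    (h : f =ᵐ[intervalMeasure L] g) (hf : ContinuousOn f (Icc 0 L))
    (hg : ContinuousOn g (Icc 0 L)) : EqOn f g (Icc 0 L) := by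
  refine Measure.eqOn_Icc_of_ae_eq volume hL.ne ?_ hf hg
  rwa [← restrict_Ioo_eq_restrict_Icc]

/-- The continuous representative of a function with integrable weak derivative is a primitive. -/
theorem IsWeakDeriv.isPrimitive_of_continuousOn {L : ℝ} (hL : 0 < L) {f g h : ℝ → ℂ}
    (hw : IsWeakDeriv L f g) (hf : IntegrableOn f (Ioo 0 L)) (hg : IntegrableOn g (Ioo 0 L))
    (hc : ContinuousOn h (Icc 0 L)) (hhf : h =ᵐ[intervalMeasure L] f) : IsPrimitive L h g := by
  obtain ⟨F, hF, hFf⟩ := hw.exists_isPrimitive hL hf hg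
  have heq := eqOn_Icc_of_ae_eq_intervalMeasure hL (hhf.trans hFf.symm) hc (hF.continuousOn hL)
  refine ⟨hg, fun x hx => ?_⟩
  rw [heq hx, heq (left_mem_Icc.2 hL.le), hF.2 x hx]

/-! ### Truncated eigenvector expansions in a Hilbert space -/

section ModeProjection

open scoped InnerProductSpace

variable {E : Type*} [NormedAddCommGroup E] [InnerProductSpace ℂ E]

/-- Bessel's inequality for the orthonormal family `D i / √(μ i)`, whose coefficients against `e'`
are `√(μ i) t i`. -/
theorem sum_mul_norm_inner_sq_le {D : ℕ → E} {μ : ℕ → ℝ} (hμ : ∀ i, 0 < μ i)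
    (hD : ∀ i j, ⟪D i, D j⟫_ℂ = if i = j then (μ i : ℂ) else 0) {e' : E} {t : ℕ → ℂ}
    (he : ∀ i, ⟪D i, e'⟫_ℂ = μ i * t i) (s : Finset ℕ) :
    ∑ i ∈ s, μ i * ‖t i‖ ^ 2 ≤ ‖e'‖ ^ 2 := by
  have hon : Orthonormal ℂ fun i => ((√(μ i))⁻¹ : ℂ) • D i := by
    rw [orthonormal_iff_ite]
    intro i j
    rw [inner_smul_left, inner_smul_right, hD]
    split_ifs with h
    · subst h
      have h1 : (√(μ i) : ℂ) ≠ 0 := by exact_mod_cast (Real.sqrt_pos.2 (hμ i)).ne'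
      have h2 : (√(μ i) : ℂ) * √(μ i) = μ i := by exact_mod_cast Real.mul_self_sqrt (hμ i).le
      rw [map_inv₀, Complex.conj_ofReal, ← h2]
      field_simp
    · simp
  refine le_trans (le_of_eq ?_) (hon.sum_inner_products_le e' (s := s))
  refine Finset.sum_congr rfl fun i _ => ?_
  have h0 := Real.sqrt_pos.2 (hμ i)
  rw [inner_smul_left, he, map_inv₀, Complex.conj_ofReal, norm_mul, norm_mul, norm_inv,
    Complex.norm_of_nonneg h0.le, Complex.norm_of_nonneg (hμ i).le, mul_pow, mul_pow, inv_pow,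
    Real.sq_sqrt (hμ i).le]
  field_simp [(hμ i).ne']

theorem inner_sub_sum_inner_smul {D : ℕ → E} {μ : ℕ → ℝ}
    (hD : ∀ i j, ⟪D i, D j⟫_ℂ = if i = j then (μ i : ℂ) else 0) {x : E} {c : ℕ → ℂ}
    (hx : ∀ i, ⟪D i, x⟫_ℂ = μ i * c i) (n i : ℕ) :
    ⟪D i, x - ∑ j ∈ Finset.range n, c j • D j⟫_ℂ = if i < n then 0 else μ i * c i := by
  rw [inner_sub_right, hx, inner_sum]
  simp only [inner_smul_right, hD, mul_ite, mul_zero, Finset.sum_ite_eq, Finset.mem_range]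
  split_ifs <;> ring

variable [CompleteSpace E]

/-- A Poincaré inequality on the complement of the first modes: Parseval for `T` expands `‖e‖²`, and
Bessel for the scaled `D i` bounds the weighted sum. The `D i` need not be complete. -/
theorem mul_norm_sq_le_of_inner_eq_zero {T D : ℕ → E} {μ : ℕ → ℝ} (hμ : ∀ i, 0 < μ i)
    (hT : Orthonormal ℂ T) (hspan : (Submodule.span ℂ (range T))ᗮ = ⊥)
    (hD : ∀ i j, ⟪D i, D j⟫_ℂ = if i = j then (μ i : ℂ) else 0) {e e' : E}
    (he : ∀ i, ⟪D i, e'⟫_ℂ = μ i * ⟪T i, e⟫_ℂ) {n : ℕ} {lam : ℝ}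
    (h0 : ∀ i < n, ⟪T i, e⟫_ℂ = 0) (hlam : ∀ i, n ≤ i → lam ≤ μ i) :
    lam * ‖e‖ ^ 2 ≤ ‖e'‖ ^ 2 := by
  let b := HilbertBasis.mkOfOrthogonalEqBot hT hspan
  have hb : ∀ i, b i = T i := fun i => by
    rw [HilbertBasis.coe_mkOfOrthogonalEqBot]
  have hs : HasSum (fun i => ‖⟪T i, e⟫_ℂ‖ ^ 2) (‖e‖ ^ 2) := by
    have := (Complex.hasSum_re (b.hasSum_inner_mul_inner e e))
    convert this using 2 with i
    · rw [hb, ← inner_conj_symm e (T i), RCLike.conj_mul]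
      norm_cast
    · rw [inner_self_eq_norm_sq_to_K]
      norm_cast
  refine hasSum_le_of_sum_le (hs.mul_left lam) fun s => ?_
  refine le_trans (Finset.sum_le_sum fun i _ => ?_) (sum_mul_norm_inner_sq_le hμ hD he s)
  rcases lt_or_ge i n with h | h
  · simp [h0 i h]
  · exact mul_le_mul_of_nonneg_right (hlam i h) (by positivity)

/-- Truncation of the expansion in an orthonormal basis `T` of eigenvectors: `D i` plays the role
of the derivative of `T i`, `v'` that of `v`. -/
theorem norm_modeRemainder_le {T D : ℕ → E} {μ : ℕ → ℝ} (hμ : ∀ i, 0 < μ i)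
    (hT : Orthonormal ℂ T) (hspan : (Submodule.span ℂ (range T))ᗮ = ⊥)
    (hD : ∀ i j, ⟪D i, D j⟫_ℂ = if i = j then (μ i : ℂ) else 0) {v v' : E}
    (hv : ∀ i, ⟪D i, v'⟫_ℂ = μ i * ⟪T i, v⟫_ℂ) {n : ℕ} {lam : ℝ} (hlam0 : 0 < lam)
    (hlam : ∀ i, n ≤ i → lam ≤ μ i) :
    √lam * ‖v - ∑ j ∈ Finset.range n, ⟪T j, v⟫_ℂ • T j‖ ≤
        ‖v' - ∑ j ∈ Finset.range n, ⟪T j, v⟫_ℂ • D j‖ ∧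
      ‖v' - ∑ j ∈ Finset.range n, ⟪T j, v⟫_ℂ • D j‖ ≤ ‖v'‖ ∧
      ∀ g : E, (∀ i, ⟪D i, v'⟫_ℂ = -⟪T i, g⟫_ℂ) → ⟪v', v'⟫_ℂ = -⟪v, g⟫_ℂ →
        √lam * ‖v' - ∑ j ∈ Finset.range n, ⟪T j, v⟫_ℂ • D j‖ ≤ ‖g‖ := by
  set e := v - ∑ j ∈ Finset.range n, ⟪T j, v⟫_ℂ • T j with he
  set e' := v' - ∑ j ∈ Finset.range n, ⟪T j, v⟫_ℂ • D j with he'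
  have hTe : ∀ i, ⟪T i, e⟫_ℂ = if i < n then 0 else ⟪T i, v⟫_ℂ := by
    intro i
    have := inner_sub_sum_inner_smul (D := T) (μ := fun _ => 1) (x := v)
      (c := fun i => ⟪T i, v⟫_ℂ)
      (fun i j => by rw [orthonormal_iff_ite.1 hT i j]; simp) (fun i => by simp) n i
    rw [← he] at this
    simpa using this
  have hDe : ∀ i, ⟪D i, e'⟫_ℂ = if i < n then 0 else μ i * ⟪T i, v⟫_ℂ := fun i =>
    inner_sub_sum_inner_smul hD hv n i
  have h1 : √lam * ‖e‖ ≤ ‖e'‖ := by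
    refine (pow_le_pow_iff_left₀ (by positivity) (norm_nonneg _) two_ne_zero).1 ?_
    rw [mul_pow, Real.sq_sqrt hlam0.le]
    refine mul_norm_sq_le_of_inner_eq_zero hμ hT hspan hD (fun i => ?_)
      (fun i hi => by rw [hTe, if_pos hi]) hlam
    rw [hDe, hTe]
    split_ifs <;> simp
  -- `e'` is orthogonal to every `D i` with `i < n`, so the subtracted sum drops out.
  have h2 : ⟪e', e'⟫_ℂ = ⟪e', v'⟫_ℂ := by
    conv_lhs => rw [he', inner_sub_right, ← he', inner_sum]
    rw [Finset.sum_eq_zero fun i hi => ?_, sub_zero]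
    rw [inner_smul_right, ← inner_conj_symm e' (D i), hDe, if_pos (Finset.mem_range.1 hi)]
    simp
  have hle : ∀ x y : E, ⟪e', e'⟫_ℂ = ⟪x, y⟫_ℂ → ‖e'‖ ^ 2 ≤ ‖x‖ * ‖y‖ := by
    intro x y h
    rw [inner_self_eq_norm_sq_to_K] at h
    have := norm_inner_le_norm (𝕜 := ℂ) x y
    rw [← h, norm_pow] at this
    simpa using this
  refine ⟨h1, ?_, fun g hg1 hg2 => ?_⟩
  · have := hle _ _ h2
    by_contra! h
    nlinarith [norm_nonneg v']
  · have h3 : ⟪e', v'⟫_ℂ = ⟪-e, g⟫_ℂ := by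
      rw [he', he, inner_neg_left, inner_sub_left, inner_sub_left, hg2, sum_inner, sum_inner]
      simp only [inner_smul_left, hg1]
      simp only [mul_neg, Finset.sum_neg_distrib]
      ring
    have h4 := hle _ _ (h2.trans h3)
    rw [norm_neg] at h4
    rcases (norm_nonneg e').eq_or_lt with h | h
    · rw [← h, mul_zero]
      exact norm_nonneg g
    · have h5 := mul_le_mul_of_nonneg_right h1 (norm_nonneg g)
      have h6 := mul_le_mul_of_nonneg_left h4 (Real.sqrt_nonneg lam)
      refine le_of_mul_le_mul_left ?_ h
      nlinarith
end ModeProjection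

/-! ### Completeness of the sines -/

theorem fourier_neg_sub_fourier_neg {L : ℝ} (hL : 0 < L) (n : ℤ) (x : ℝ) :
    (fourier (-n) (x : AddCircle (L - -L)) : ℂ) - fourier (-n) ((-x : ℝ) : AddCircle (L - -L)) =
      -2 * Complex.I * Real.sin (n * Real.pi * x / L) := by
  have hL' : (L : ℂ) ≠ 0 := by exact_mod_cast hL.ne'
  rw [fourier_coe_apply, fourier_coe_apply, Complex.ofReal_sin, Complex.sin]
  have e1 : 2 * (Real.pi : ℂ) * Complex.I * ((-n : ℤ) : ℂ) * (x : ℂ) / ((L - -L : ℝ) : ℂ) =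
      -((n * Real.pi * x / L : ℝ) : ℂ) * Complex.I := by
    push_cast
    field_simp
    ring
  have e2 : 2 * (Real.pi : ℂ) * Complex.I * ((-n : ℤ) : ℂ) * ((-x : ℝ) : ℂ) / ((L - -L : ℝ) : ℂ) =
      ((n * Real.pi * x / L : ℝ) : ℂ) * Complex.I := by
    push_cast
    field_simp
    ring
  rw [e1, e2]
  linear_combination (Complex.exp (-((n * Real.pi * x / L : ℝ) : ℂ) * Complex.I) -
    Complex.exp (((n * Real.pi * x / L : ℝ) : ℂ) * Complex.I)) * Complex.I_sq

/-- The functions `sin (m π s / L)`, `m ≥ 1`, are complete in `L²(0, L)`. -/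
theorem ae_eq_zero_of_forall_integral_sin_mul_eq_zero {L : ℝ} (hL : 0 < L) {f : ℝ → ℂ}
    (hf : MemLp f 2 (intervalMeasure L))
    (h : ∀ m : ℕ, 1 ≤ m → ∫ s in Ioo 0 L, (Real.sin (m * Real.pi * s / L) : ℂ) * f s = 0) :
    f =ᵐ[intervalMeasure L] 0 := by
  have hLL : -L < L := by linarith
  have hsub : Ioo 0 L ⊆ Ioc (-L) L := fun x hx => ⟨by linarith [hx.1], hx.2.le⟩
  set f₀ := (Ioo 0 L).indicator f with hf₀
  have hm₀ : MemLp f₀ 2 volume := (memLp_indicator_iff_restrict measurableSet_Ioo).2 hf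
  have hm₁ : MemLp (fun x => f₀ (-x)) 2 volume :=
    hm₀.comp_measurePreserving (Measure.measurePreserving_neg volume)
  -- The odd extension of `f` to `(-L, L)`: its Fourier coefficients are multiples of the sine
  -- integrals of `f`, so all vanish, and Parseval forces `g = 0`.
  set g : ℝ → ℂ := fun x => f₀ x - f₀ (-x) with hg
  have hgm : MemLp g 2 (volume.restrict (Ioc (-L) L)) := (hm₀.sub hm₁).restrict _
  have hsin : ∀ n : ℤ, ∫ s in Ioo 0 L, (Real.sin (n * Real.pi * s / L) : ℂ) * f s = 0 := by
    intro n
    rcases lt_trichotomy n 0 with hn | rfl | hn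
    · obtain ⟨m, hm⟩ := Int.eq_ofNat_of_zero_le (show 0 ≤ -n by omega)
      obtain rfl : n = -(m : ℤ) := by omega
      have := h m (by omega)
      rw [← neg_eq_zero, ← integral_neg, ← this]
      congr 1 with s
      push_cast
      rw [show (-(m : ℂ) * Real.pi * s / L) = -(m * Real.pi * s / L) by ring, Complex.sin_neg]
      ring
    · simp
    · obtain ⟨m, rfl⟩ := Int.eq_ofNat_of_zero_le hn.le
      simpa using h m (by omega)
  have hcoef : ∀ n : ℤ, fourierCoeffOn hLL g n = 0 := by
    intro n
    have hE : Continuous fun x : ℝ => (fourier (-n) (x : AddCircle (L - -L)) : ℂ) :=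
      (map_continuous (fourier (-n))).comp (AddCircle.continuous_mk' _)
    have hi : ∀ k : ℝ → ℂ, MemLp k 2 volume → IntervalIntegrable k volume (-L) L := fun k hk =>
      (intervalIntegrable_iff_integrableOn_Ioc_of_le hLL.le).2
        ((hk.restrict _).integrable one_le_two)
    have i1 := (hi _ hm₀).continuousOn_mul hE.continuousOn
    have i2 := (hi _ hm₁).continuousOn_mul hE.continuousOn
    have i3 : IntervalIntegrable
        (fun x : ℝ => (fourier (-n) ((-x : ℝ) : AddCircle (L - -L)) : ℂ) * f₀ x) volume (-L) L :=
      (hi _ hm₀).continuousOn_mul (hE.comp continuous_neg).continuousOn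
    rw [fourierCoeffOn_eq_integral]
    simp only [smul_eq_mul, hg, mul_sub]
    rw [intervalIntegral.integral_sub i1 i2]
    -- The reflection is moved from `f₀` to the exponential, so that only the odd part of the
    -- exponential meets `f₀`.
    have := intervalIntegral.integral_comp_neg (a := -L) (b := L)
      fun x : ℝ => (fourier (-n) ((-x : ℝ) : AddCircle (L - -L)) : ℂ) * f₀ x
    simp only [neg_neg] at this
    rw [this, ← intervalIntegral.integral_sub i1 i3]
    simp only [← sub_mul, fourier_neg_sub_fourier_neg hL]
    rw [intervalIntegral.integral_of_le hLL.le]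
    have e : ∀ x : ℝ, -2 * Complex.I * Real.sin (n * Real.pi * x / L) * f₀ x =
        (Ioo 0 L).indicator
          (fun x => -2 * Complex.I * ((Real.sin (n * Real.pi * x / L) : ℂ) * f x)) x := by
      intro x
      by_cases hx : x ∈ Ioo 0 L <;> simp [hf₀, hx, mul_assoc]
    simp only [e]
    rw [setIntegral_indicator measurableSet_Ioo, inter_eq_right.2 hsub, integral_const_mul, hsin, mul_zero, smul_zero]
  have hsum := hasSum_sq_fourierCoeffOn hLL hgm
  simp only [hcoef, norm_zero, ne_eq, OfNat.ofNat_ne_zero, not_false_eq_true, zero_pow] at hsum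
  have h0 := (hsum.unique hasSum_zero)
  have hne : (L - -L)⁻¹ ≠ 0 := inv_ne_zero (by linarith)
  rw [smul_eq_zero_iff_right hne, intervalIntegral.integral_of_le hLL.le,
    integral_eq_zero_iff_of_nonneg (fun x => by positivity) (hgm.integrable_norm_pow two_ne_zero)] at h0
  have h1 : g =ᵐ[intervalMeasure L] 0 := by
    have : g =ᵐ[volume.restrict (Ioc (-L) L)] 0 := h0.mono fun x hx => by simpa using hx
    exact ae_restrict_of_ae_restrict_of_subset hsub this
  have h2 : ∀ᵐ x ∂intervalMeasure L, x ∈ Ioo 0 L := ae_restrict_mem measurableSet_Ioo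
  filter_upwards [h1, h2] with x hx hxI
  rw [hg] at hx
  have : -x ∉ Ioo 0 L := fun h => by linarith [h.1, hxI.1]
  simpa [hf₀, hxI, this] using hx

/-! ### Sobolev functions on the interval -/

instance (L : ℝ) : IsFiniteMeasure (intervalMeasure L) := by
  unfold intervalMeasure
  infer_instance

theorem MeasureTheory.MemLp.integrableOn_Ioo {L : ℝ} {f : ℝ → ℂ}
    (hf : MemLp f 2 (intervalMeasure L)) : IntegrableOn f (Ioo 0 L) :=
  hf.integrable one_le_two

theorem memLp_intervalMeasure_of_continuousOn {L : ℝ} {f : ℝ → ℂ} (hf : ContinuousOn f (Icc 0 L)) :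
    MemLp f 2 (intervalMeasure L) := by
  obtain ⟨C, hC⟩ := isCompact_Icc.exists_bound_of_continuousOn hf
  refine MemLp.of_bound ((hf.mono Ioo_subset_Icc_self).aestronglyMeasurable measurableSet_Ioo) C ?_
  exact (ae_restrict_mem measurableSet_Ioo).mono fun x hx => hC x (Ioo_subset_Icc_self hx)

theorem exists_isWeakDerivChain_of_sobolevNorm_lt_top {L : ℝ} {k : ℕ} {f : ℝ → ℂ}
    (h : sobolevNorm L k f < ⊤) : ∃ g, IsWeakDerivChain L k f g := by
  simp only [sobolevNorm, iInf_lt_iff] at h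
  obtain ⟨g, hg, -⟩ := h
  exact ⟨g, hg⟩

theorem IsWeakDerivChain.sobolevNorm_lt_top {L : ℝ} {k : ℕ} {f : ℝ → ℂ} {g : ℕ → ℝ → ℂ}
    (h : IsWeakDerivChain L k f g) : sobolevNorm L k f < ⊤ := by
  refine (iInf₂_le g h).trans_lt (ENNReal.rpow_lt_top_of_nonneg (by norm_num) ?_)
  refine (ENNReal.sum_lt_top.2 fun i hi => ?_).ne
  exact ENNReal.pow_lt_top (h.2.1 i (by simpa [Nat.lt_succ_iff] using hi)).2

theorem IsWeakDeriv.isWeakDerivChain_one {L : ℝ} {f f' : ℝ → ℂ} (h : IsWeakDeriv L f f')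
    (hf : MemLp f 2 (intervalMeasure L)) (hf' : MemLp f' 2 (intervalMeasure L)) :
    IsWeakDerivChain L 1 f (fun i => if i = 0 then f else f') := by
  refine ⟨by simp, fun i hi => ?_, fun i hi => ?_⟩
  · beta_reduce
    split_ifs
    exacts [hf, hf']
  · obtain rfl : i = 0 := by omega
    simpa using h

/-- The continuous representative that carries the zero trace is itself a primitive of the weak
derivative, so integration by parts applies to it without boundary terms. -/
theorem MemH10.exists_isPrimitive {L : ℝ} (hL : 0 < L) {f : ℝ → ℂ} (h : MemH10 L f) :
    ∃ F f', IsPrimitive L F f' ∧ MemLp f' 2 (intervalMeasure L) ∧ F =ᵐ[intervalMeasure L] f ∧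
      F 0 = 0 ∧ F L = 0 := by
  obtain ⟨h1, F, hc, hF, h0, hL0⟩ := h
  obtain ⟨g, rfl, hg, hw⟩ := exists_isWeakDerivChain_of_sobolevNorm_lt_top h1
  exact ⟨F, g 1, (hw 0 one_pos).isPrimitive_of_continuousOn hL (hg 0 zero_le_one).integrableOn_Ioo
    (hg 1 le_rfl).integrableOn_Ioo hc hF, hg 1 le_rfl, hF, h0, hL0⟩

theorem IsPrimitive.memLp {L : ℝ} (hL : 0 < L) {F f' : ℝ → ℂ} (h : IsPrimitive L F f') :
    MemLp F 2 (intervalMeasure L) :=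
  memLp_intervalMeasure_of_continuousOn (h.continuousOn hL)

theorem IsPrimitive.memH10 {L : ℝ} (hL : 0 < L) {F f' f : ℝ → ℂ} (h : IsPrimitive L F f')
    (hf' : MemLp f' 2 (intervalMeasure L)) (hF : F =ᵐ[intervalMeasure L] f) (h0 : F 0 = 0)
    (hL0 : F L = 0) : MemH10 L f :=
  ⟨(((h.isWeakDeriv hL).congr hF (ae_eq_refl _)).isWeakDerivChain_one
    ((memLp_congr_ae hF).1 (h.memLp hL)) hf').sobolevNorm_lt_top,
    F, h.continuousOn hL, hF, h0, hL0⟩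

theorem IsPrimitive.conj {L : ℝ} {F f : ℝ → ℂ} (h : IsPrimitive L F f) :
    IsPrimitive L (fun x => starRingEnd ℂ (F x)) (fun x => starRingEnd ℂ (f x)) := by
  refine ⟨Complex.conjCLE.toContinuousLinearMap.integrable_comp h.1, fun x hx => ?_⟩
  beta_reduce
  rw [h.2 x hx, map_add, intervalIntegral.integral_of_le hx.1, intervalIntegral.integral_of_le hx.1,
    integral_conj]

/-- Integration by parts against a function which vanishes at the end points. -/
theorem IsPrimitive.integral_mul_conj_eq_neg {L : ℝ} (hL : 0 < L) {X x Y y : ℝ → ℂ}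
    (hX : IsPrimitive L X x) (h0 : X 0 = 0) (hL0 : X L = 0) (hY : IsPrimitive L Y y) :
    ∫ s in Ioo 0 L, Y s * starRingEnd ℂ (x s) = -∫ s in Ioo 0 L, y s * starRingEnd ℂ (X s) := by
  have := hY.integral_mul_add_integral_mul hL hX.conj
  simp only [h0, hL0, map_zero, mul_zero, sub_zero] at this
  exact eq_neg_of_add_eq_zero_left this

theorem setIntegral_mul_conj_congr {L : ℝ} {f f' g g' : ℝ → ℂ} (hf : f =ᵐ[intervalMeasure L] f')
    (hg : g =ᵐ[intervalMeasure L] g') :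
    ∫ s in Ioo 0 L, f s * starRingEnd ℂ (g s) = ∫ s in Ioo 0 L, f' s * starRingEnd ℂ (g' s) := by
  refine integral_congr_ae ?_
  filter_upwards [hf, hg] with x h1 h2
  rw [h1, h2]

/-! ### Edge modes: positive eigenvalues and completeness -/

namespace InterfaceEdge

variable (e : InterfaceEdge)

/-- The function on the plane with given values along the edge. -/
noncomputable def extend (f : ℝ → ℂ) : EuclideanPlane → ℂ :=
  fun x => f (Function.invFunOn e.param (Icc 0 e.length) x)

theorem extend_param (f : ℝ → ℂ) {s : ℝ} (hs : s ∈ Icc 0 e.length) : e.extend f (e.param s) = f s := by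
  unfold extend
  rw [e.injOn.leftInvOn_invFunOn hs]

theorem extend_comp_param_ae_eq (f : ℝ → ℂ) :
    e.extend f ∘ e.param =ᵐ[intervalMeasure e.length] f :=
  (ae_restrict_mem measurableSet_Ioo).mono fun _ hs => e.extend_param f (Ioo_subset_Icc_self hs)

/-- These explicit eigenpairs are what the exhaustion property of the modes is applied to. The weak
equation is one integration by parts from `ω cos` to `-ω² sin`. -/
theorem isEigenpair_extend_sin (m : ℕ) :
    e.IsEigenpair (e.extend fun s => (Real.sin (m * Real.pi * s / e.length) : ℂ))
      ((m * Real.pi / e.length) ^ 2) := by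
  have hL := e.length_pos
  set L := e.length
  set ω : ℝ := m * Real.pi / L with hω
  have e1 : (fun s : ℝ => (Real.sin (m * Real.pi * s / L) : ℂ)) = fun s => (Real.sin (ω * s) : ℂ) := by
    ext s
    rw [hω, div_mul_eq_mul_div]
  rw [e1]
  have hS : IsPrimitive L (fun s => (Real.sin (ω * s) : ℂ)) (fun s => ω * (Real.cos (ω * s) : ℂ)) :=
    isPrimitive_of_hasDerivAt (fun s => by
      have h1 : HasDerivAt (fun s : ℝ => ω * s) ω s := by simpa using (hasDerivAt_id s).const_mul ω
      simpa [mul_comm] using (h1.sin).ofReal_comp) (by fun_prop)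
  have hC : IsPrimitive L (fun s => ω * (Real.cos (ω * s) : ℂ))
      (fun s => -(ω ^ 2 * (Real.sin (ω * s) : ℂ))) :=
    isPrimitive_of_hasDerivAt (fun s => by
      have h1 : HasDerivAt (fun s : ℝ => ω * s) ω s := by simpa using (hasDerivAt_id s).const_mul ω
      refine ((h1.cos).ofReal_comp.const_mul (ω : ℂ)).congr_deriv ?_
      push_cast
      ring) (by fun_prop)
  have hS0 : ((Real.sin (ω * 0) : ℝ) : ℂ) = 0 := by simp
  have hSL : ((Real.sin (ω * L) : ℝ) : ℂ) = 0 := by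
    rw [hω, div_mul_cancel₀ _ hL.ne', Real.sin_nat_mul_pi, Complex.ofReal_zero]
  have hae := e.extend_comp_param_ae_eq fun s => (Real.sin (ω * s) : ℂ)
  refine ⟨hS.memH10 hL (hC.memLp hL) hae.symm hS0 hSL, fun η hη dτ dη h1 h2 h3 h4 => ?_⟩
  obtain ⟨H, h', hH, hh', hHη, H0, HL⟩ := hη.exists_isPrimitive hL
  have a1 := ((h2.congr hae (ae_eq_refl _)).unique (hS.isWeakDeriv hL) h1.integrableOn_Ioo hS.1)
  have a2 := ((h4.congr hHη.symm (ae_eq_refl _)).unique (hH.isWeakDeriv hL) h3.integrableOn_Ioo hH.1)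
  rw [setIntegral_mul_conj_congr a1 a2, hH.integral_mul_conj_eq_neg hL H0 HL hC,
    setIntegral_mul_conj_congr (f := fun s => e.extend _ (e.param s)) hae hHη.symm,
    ← integral_neg, ← integral_const_mul]
  congr 1 with s
  push_cast
  ring

variable {e}

namespace IsEdgeModes

variable {τ : ℕ → EuclideanPlane → ℂ} {ev : ℕ → ℝ}

theorem memLp (h : e.IsEdgeModes τ ev) {i : ℕ} (hi : 1 ≤ i) :
    MemLp (τ i ∘ e.param) 2 (intervalMeasure e.length) := by
  obtain ⟨F, f', hF, -, hae, -⟩ := (h.eigenpair i hi).1.exists_isPrimitive e.length_pos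
  exact (memLp_congr_ae hae).1 (hF.memLp e.length_pos)

theorem integral_mul_conj_eq (h : e.IsEdgeModes τ ev) {i : ℕ} (hi : 1 ≤ i) {X d V v : ℝ → ℂ}
    (hX : IsPrimitive e.length X d) (hd : MemLp d 2 (intervalMeasure e.length))
    (hXτ : X =ᵐ[intervalMeasure e.length] τ i ∘ e.param)
    (hV : IsPrimitive e.length V v) (hv : MemLp v 2 (intervalMeasure e.length)) (hV0 : V 0 = 0)
    (hVL : V e.length = 0) :
    ∫ s in Ioo 0 e.length, d s * starRingEnd ℂ (v s) =
      ev i * ∫ s in Ioo 0 e.length, τ i (e.param s) * starRingEnd ℂ (V s) :=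
  (h.eigenpair i hi).2 V (hV.memH10 e.length_pos hv (ae_eq_refl _) hV0 hVL) d v hd
    ((hX.isWeakDeriv e.length_pos).congr hXτ (ae_eq_refl _)) hv (hV.isWeakDeriv e.length_pos)

/-- Testing the mode with itself gives `ev i = ‖∂τ_i‖²`. If this were zero, `τ_i` would be constant
with zero end values, contradicting its unit norm. -/
theorem ev_pos (h : e.IsEdgeModes τ ev) {i : ℕ} (hi : 1 ≤ i) : 0 < ev i := by
  have hL := e.length_pos
  obtain ⟨X, d, hX, hd, hae, h0, hL0⟩ := (h.eigenpair i hi).1.exists_isPrimitive hL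
  have h1 := h.integral_mul_conj_eq hi hX hd hae hX hd h0 hL0
  have h2 := h.orthonormal i i hi hi
  rw [if_pos rfl] at h2
  rw [setIntegral_mul_conj_congr (f := fun s => τ i (e.param s)) (ae_eq_refl _) hae] at h1
  have h3 : ∫ s in Ioo 0 e.length, d s * starRingEnd ℂ (d s) = ev i := by
    rw [h1]
    exact (congrArg _ h2).trans (mul_one _)
  have h4 : ∫ s in Ioo 0 e.length, ‖d s‖ ^ 2 = ev i := by
    have : ∀ s, d s * starRingEnd ℂ (d s) = ((‖d s‖ ^ 2 : ℝ) : ℂ) := fun s => by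
      rw [RCLike.mul_conj]
      norm_cast
    simp only [this] at h3
    rw [integral_complex_ofReal] at h3
    exact_mod_cast h3
  have hnn : 0 ≤ ev i := h4 ▸ integral_nonneg fun s => by positivity
  have hdi : Integrable (fun s => ‖d s‖ ^ 2) (volume.restrict (Ioo 0 e.length)) :=
    hd.integrable_norm_pow two_ne_zero
  refine hnn.lt_of_ne fun h5 => ?_
  rw [← h5, integral_eq_zero_iff_of_nonneg (fun s => by positivity)
    hdi] at h4
  have hd0 : d =ᵐ[volume.restrict (Ioo 0 e.length)] 0 := h4.mono fun s hs => by simpa using hs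
  have hX0 : ∀ s ∈ Icc 0 e.length, X s = 0 := by
    intro s hs
    rw [hX.2 s hs, h0, zero_add, intervalIntegral.integral_of_le hs.1,
      integral_Ioc_eq_integral_Ioo]
    refine integral_eq_zero_of_ae ?_
    exact ae_restrict_of_ae_restrict_of_subset (Ioo_subset_Ioo_right hs.2) hd0
  have : ∫ s in Ioo 0 e.length, τ i (e.param s) * starRingEnd ℂ (τ i (e.param s)) = 0 := by
    have h6 := setIntegral_mul_conj_congr hae hae
    simp only [Function.comp] at h6
    rw [← h6]
    refine (setIntegral_congr_fun measurableSet_Ioo fun s hs => ?_).trans (integral_zero _ _)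
    simp [hX0 s (Ioo_subset_Icc_self hs)]
  rw [this] at h2
  exact zero_ne_one h2

theorem memLp_and_integral_eq_zero_of_mem_span (h : e.IsEdgeModes τ ev) {f : ℝ → ℂ}
    (hf : MemLp f 2 (intervalMeasure e.length))
    (hfτ : ∀ i, 1 ≤ i → ∫ s in Ioo 0 e.length, f s * starRingEnd ℂ (τ i (e.param s)) = 0)
    {S : Set ℕ} (hS : ∀ i ∈ S, 1 ≤ i) {v : EuclideanPlane → ℂ}
    (hv : v ∈ Submodule.span ℂ (τ '' S)) :
    MemLp (v ∘ e.param) 2 (intervalMeasure e.length) ∧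
      ∫ s in Ioo 0 e.length, f s * starRingEnd ℂ (v (e.param s)) = 0 := by
  induction hv using Submodule.span_induction with
  | mem x hx =>
    obtain ⟨i, hi, rfl⟩ := hx
    exact ⟨h.memLp (hS i hi), hfτ i (hS i hi)⟩
  | zero => simp [Function.comp_def]
  | add x y _ _ hx hy =>
    refine ⟨hx.1.add hy.1, ?_⟩
    simp only [Pi.add_apply, map_add, mul_add]
    have i1 : ∀ w : EuclideanPlane → ℂ, MemLp (w ∘ e.param) 2 (intervalMeasure e.length) →
        IntegrableOn (fun s => f s * starRingEnd ℂ (w (e.param s))) (Ioo 0 e.length) :=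
      fun w hw => hf.integrable_mul hw.star
    rw [integral_add (i1 x hx.1) (i1 y hy.1), hx.2, hy.2, add_zero]
  | smul a x _ hx =>
    refine ⟨hx.1.const_smul a, ?_⟩
    simp only [Pi.smul_apply, smul_eq_mul, map_mul, mul_left_comm (f _)]
    rw [integral_const_mul, hx.2, mul_zero]

/-- The edge modes are complete in `L²`. -/
theorem ae_eq_zero_of_forall_integral_eq_zero (h : e.IsEdgeModes τ ev) {f : ℝ → ℂ}
    (hf : MemLp f 2 (intervalMeasure e.length))
    (hfτ : ∀ i, 1 ≤ i → ∫ s in Ioo 0 e.length, f s * starRingEnd ℂ (τ i (e.param s)) = 0) :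
    f =ᵐ[intervalMeasure e.length] 0 := by
  refine ae_eq_zero_of_forall_integral_sin_mul_eq_zero e.length_pos hf fun m _ => ?_
  -- The sine agrees almost everywhere with a finite combination of modes, to all of which `f` is
  -- orthogonal; being real, it loses its conjugation.
  obtain ⟨v, hv, hve⟩ := h.exhaustive _ _ (e.isEigenpair_extend_sin m)
  have h1 := (h.memLp_and_integral_eq_zero_of_mem_span hf hfτ (fun i hi => hi.1) hv).2
  rw [← h1]
  refine integral_congr_ae ?_
  have h2 := hve.trans (e.extend_comp_param_ae_eq _)
  filter_upwards [h2] with s hs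
  have hs' : v (e.param s) = _ := hs
  rw [hs', Complex.conj_ofReal, mul_comm]

end IsEdgeModes

end InterfaceEdge

/-! ### The residual after affine interpolation and mode projection -/

section Residual

open scoped InnerProductSpace

theorem inner_toLp_intervalMeasure {L : ℝ} {f g : ℝ → ℂ} (hf : MemLp f 2 (intervalMeasure L))
    (hg : MemLp g 2 (intervalMeasure L)) :
    ⟪hf.toLp f, hg.toLp g⟫_ℂ = ∫ s in Ioo 0 L, g s * starRingEnd ℂ (f s) := by
  rw [L2.inner_def]
  refine integral_congr_ae ?_
  filter_upwards [hf.coeFn_toLp, hg.coeFn_toLp] with s h1 h2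
  rw [h1, h2, RCLike.inner_apply]

theorem integral_conj_swap {L : ℝ} (f g : ℝ → ℂ) :
    ∫ s in Ioo 0 L, g s * starRingEnd ℂ (f s) =
      starRingEnd ℂ (∫ s in Ioo 0 L, f s * starRingEnd ℂ (g s)) := by
  rw [← integral_conj]
  congr 1 with s
  rw [map_mul, Complex.conj_conj, mul_comm]

/-- The affine function on `[0, L]` with the same boundary values as `h`. -/
noncomputable def affineInterpolant (L : ℝ) (h : ℝ → ℂ) (s : ℝ) : ℂ :=
  h 0 + (s / L : ℝ) * (h L - h 0)

theorem IsPrimitive.sub_affineInterpolant {L : ℝ} {h h' : ℝ → ℂ} (hh : IsPrimitive L h h') :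
    IsPrimitive L (fun s => h s - affineInterpolant L h s) (fun s => h' s - (h L - h 0) / L) := by
  have hc : IntegrableOn (fun _ : ℝ => (h L - h 0) / (L : ℂ)) (Ioo 0 L) := by simp
  refine ⟨hh.1.sub hc, fun x hx => ?_⟩
  beta_reduce
  rw [intervalIntegral.integral_sub (hh.intervalIntegrable hx) (by simp), hh.2 x hx]
  simp only [affineInterpolant, intervalIntegral.integral_const, Complex.real_smul]
  push_cast
  ring

theorem sub_affineInterpolant_ends {L : ℝ} (hL : 0 < L) (h : ℝ → ℂ) :
    h 0 - affineInterpolant L h 0 = 0 ∧ h L - affineInterpolant L h L = 0 := by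
  simp [affineInterpolant, hL.ne']

/-- `h` minus its affine interpolant minus the `L²` projection of this difference to the span of
`T 1, …, T n`. -/
noncomputable def modeResidual (L : ℝ) (T : ℕ → ℝ → ℂ) (n : ℕ) (h : ℝ → ℂ) (s : ℝ) : ℂ :=
  h s - affineInterpolant L h s - ∑ i ∈ Finset.range n,
    (∫ r in Ioo 0 L, (h r - affineInterpolant L h r) * starRingEnd ℂ (T (i + 1) r)) * T (i + 1) s

theorem eLpNorm_le_of_mul_norm_le {L c : ℝ} (hc : 0 ≤ c)
    {x y : Lp ℂ 2 (intervalMeasure L)} (h : c * ‖x‖ ≤ ‖y‖) :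
    ENNReal.ofReal c * eLpNorm x 2 (intervalMeasure L) ≤ eLpNorm y 2 (intervalMeasure L) := by
  rw [← Lp.enorm_def, ← Lp.enorm_def, ← ofReal_norm, ← ofReal_norm, ← ENNReal.ofReal_mul hc]
  exact ENNReal.ofReal_le_ofReal h

theorem coeFn_toLp_sub_sum {L : ℝ} {f : ℝ → ℂ} {T : ℕ → ℝ → ℂ}
    (hf : MemLp f 2 (intervalMeasure L)) (hT : ∀ i, MemLp (T i) 2 (intervalMeasure L)) (c : ℕ → ℂ)
    (n : ℕ) :
    ((hf.toLp f - ∑ i ∈ Finset.range n, c i • (hT i).toLp (T i) : Lp ℂ 2 (intervalMeasure L)) :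
      ℝ → ℂ) =ᵐ[intervalMeasure L] fun s => f s - ∑ i ∈ Finset.range n, c i * T i s := by
  have h1 : ∀ᵐ s ∂intervalMeasure L, ∀ i, (c i • (hT i).toLp (T i) : Lp ℂ 2 _) s = c i * T i s :=
    ae_all_iff.2 fun i => by
      filter_upwards [Lp.coeFn_smul (c i) ((hT i).toLp (T i)), (hT i).coeFn_toLp] with s h2 h3
      rw [h2, Pi.smul_apply, h3, smul_eq_mul]
  filter_upwards [h1, hf.coeFn_toLp, Lp.coeFn_sub (hf.toLp f)
    (∑ i ∈ Finset.range n, c i • (hT i).toLp (T i)), Lp.coeFn_finsetSum (Finset.range n)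
    fun i => c i • (hT i).toLp (T i)] with s h2 h3 h4 h5
  rw [h4, Pi.sub_apply, h3, h5, Finset.sum_apply]
  simp only [h2]

namespace InterfaceEdge.IsEdgeModes

variable {e : InterfaceEdge} {τ : ℕ → EuclideanPlane → ℂ} {ev : ℕ → ℝ}

/-- `norm_modeRemainder_le` in `L²`, with `T i` the mode `τ (i + 1)`, `D i` its derivative, and `V`
the function `f` minus its affine interpolant. `V` vanishes at both ends, so it is admissible in the
eigenvalue equation. -/
theorem exists_modeResidual_deriv (h : e.IsEdgeModes τ ev) {n : ℕ} (hn : 1 ≤ n) {f f' : ℝ → ℂ}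
    (hf : IsPrimitive e.length f f') (hf' : MemLp f' 2 (intervalMeasure e.length)) :
    ∃ R', IsWeakDeriv e.length (modeResidual e.length (fun i => τ i ∘ e.param) n f) R' ∧
      MemLp (modeResidual e.length (fun i => τ i ∘ e.param) n f) 2 (intervalMeasure e.length) ∧
      MemLp R' 2 (intervalMeasure e.length) ∧
      ENNReal.ofReal √(ev n) * eLpNorm (modeResidual e.length (fun i => τ i ∘ e.param) n f) 2
        (intervalMeasure e.length) ≤ eLpNorm f' 2 (intervalMeasure e.length) ∧
      ∀ f'' : ℝ → ℂ, IsWeakDeriv e.length f' f'' → MemLp f'' 2 (intervalMeasure e.length) →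
        ENNReal.ofReal √(ev n) * eLpNorm R' 2 (intervalMeasure e.length) ≤
          eLpNorm f'' 2 (intervalMeasure e.length) := by
  have hL := e.length_pos
  set L := e.length
  have hex : ∀ i, ∃ X d, IsPrimitive L X d ∧ MemLp d 2 (intervalMeasure L) ∧
      X =ᵐ[intervalMeasure L] τ (i + 1) ∘ e.param ∧ X 0 = 0 ∧ X L = 0 := fun i =>
    (h.eigenpair (i + 1) (by omega)).1.exists_isPrimitive hL
  choose X d hX hd hXae hX0 hXL using hex
  have hτ : ∀ i, MemLp (τ (i + 1) ∘ e.param) 2 (intervalMeasure L) := fun i => h.memLp (by omega)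
  have hμ : ∀ i, 0 < ev (i + 1) := fun i => h.ev_pos (by omega)
  set V : ℝ → ℂ := fun s => f s - affineInterpolant L f s with hVdef
  set m : ℂ := (f L - f 0) / L with hm
  set v : ℝ → ℂ := fun s => f' s - m with hvdef
  have hV : IsPrimitive L V v := hf.sub_affineInterpolant
  obtain ⟨hV0, hVL⟩ := sub_affineInterpolant_ends hL f
  have hv : MemLp v 2 (intervalMeasure L) := hf'.sub (memLp_const m)
  have hVm := hV.memLp hL
  set T : ℕ → Lp ℂ 2 (intervalMeasure L) := fun i => (hτ i).toLp _ with hTdef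
  set D : ℕ → Lp ℂ 2 (intervalMeasure L) := fun i => (hd i).toLp _ with hDdef
  have hTon : Orthonormal ℂ T := by
    rw [orthonormal_iff_ite]
    intro i j
    rw [inner_toLp_intervalMeasure]
    refine (h.orthonormal (j + 1) (i + 1) (by omega) (by omega)).trans ?_
    simp [eq_comm]
  have hspan : (Submodule.span ℂ (range T))ᗮ = ⊥ := by
    rw [Submodule.eq_bot_iff]
    intro x hx
    have hx' : ∀ i, 1 ≤ i → ∫ s in Ioo 0 L, x s * starRingEnd ℂ (τ i (e.param s)) = 0 := by
      intro i hi
      obtain ⟨j, rfl⟩ : ∃ j, i = j + 1 := ⟨i - 1, by omega⟩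
      have := (Submodule.mem_orthogonal _ _).1 hx (T j) (Submodule.subset_span ⟨j, rfl⟩)
      rw [← Lp.toLp_coeFn x (Lp.memLp x), inner_toLp_intervalMeasure] at this
      exact this
    have := h.ae_eq_zero_of_forall_integral_eq_zero (Lp.memLp x) hx'
    exact (Lp.eq_zero_iff_ae_eq_zero).2 this
  -- The eigenvalue equation with the mode in the conjugate-linear slot; the real eigenvalue
  -- survives the conjugation. It yields both the orthogonality of the `D i` and the hypothesis on
  -- `v`.
  have heig : ∀ i, ∀ W w : ℝ → ℂ, IsPrimitive L W w → ∀ hW : MemLp W 2 (intervalMeasure L),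
      ∀ hw : MemLp w 2 (intervalMeasure L), W 0 = 0 → W L = 0 →
      ⟪D i, hw.toLp w⟫_ℂ = ev (i + 1) * ⟪T i, hW.toLp W⟫_ℂ := by
    intro i W w hWw hW hw h0 h1
    rw [inner_toLp_intervalMeasure, inner_toLp_intervalMeasure, integral_conj_swap,
      integral_conj_swap (τ (i + 1) ∘ e.param),
      h.integral_mul_conj_eq (by omega) (hX i) (hd i) (hXae i) hWw hw h0 h1, map_mul,
      Complex.conj_ofReal]
    rfl
  have hD : ∀ i j, ⟪D i, D j⟫_ℂ = if i = j then ((ev (i + 1) : ℝ) : ℂ) else 0 := by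
    intro i j
    have hXm := (hX j).memLp hL
    rw [heig i (X j) (d j) (hX j) hXm (hd j) (hX0 j) (hXL j), MemLp.toLp_congr hXm (hτ j) (hXae j)]
    rw [show ⟪T i, MemLp.toLp _ (hτ j)⟫_ℂ = ⟪T i, T j⟫_ℂ from rfl, orthonormal_iff_ite.1 hTon i j]
    simp
  -- The modes left over have eigenvalues from `ev (n + 1)` on; the weaker bound by `ev n` is all
  -- that is claimed.
  have hlam : ∀ i, n ≤ i → ev n ≤ ev (i + 1) := fun i hi => h.monotone n (i + 1) hn (by omega)
  obtain ⟨b1, b2, b3⟩ := norm_modeRemainder_le (v := hVm.toLp V) (v' := hv.toLp v) hμ hTon hspan hD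
    (fun i => heig i V v hV hVm hv hV0 hVL) (n := n) (h.ev_pos hn) hlam
  set c : ℕ → ℂ := fun i => ⟪T i, hVm.toLp V⟫_ℂ with hc
  have hR := coeFn_toLp_sub_sum hVm hτ c n
  have hR' := coeFn_toLp_sub_sum hv hd c n
  have hRe : modeResidual L (fun i => τ i ∘ e.param) n f =
      fun s => V s - ∑ i ∈ Finset.range n, c i * (τ (i + 1) ∘ e.param) s := by
    ext s
    simp only [modeResidual, hc, hTdef, inner_toLp_intervalMeasure, hVdef]
  rw [hRe]
  refine ⟨fun s => v s - ∑ i ∈ Finset.range n, c i * d i s, ?_, ?_, ?_, ?_, ?_⟩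
  · have hwd : ∀ i, IsWeakDeriv L (τ (i + 1) ∘ e.param) (d i) := fun i =>
      ((hX i).isWeakDeriv hL).congr (hXae i) (ae_eq_refl _)
    refine (hV.isWeakDeriv hL).sub (IsWeakDeriv.sum_const_mul _ c (fun i _ => hwd i)
      (fun i _ => (hτ i).integrableOn_Ioo) fun i _ => (hd i).integrableOn_Ioo)
      hVm.integrableOn_Ioo ?_ hv.integrableOn_Ioo ?_
    · exact integrable_finsetSum _ fun i _ => (hτ i).integrableOn_Ioo.const_mul _
    · exact integrable_finsetSum _ fun i _ => (hd i).integrableOn_Ioo.const_mul _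
  · exact (memLp_congr_ae hR).1 (Lp.memLp _)
  · exact (memLp_congr_ae hR').1 (Lp.memLp _)
  · rw [← eLpNorm_congr_ae hR, ← eLpNorm_congr_ae hf'.coeFn_toLp]
    refine eLpNorm_le_of_mul_norm_le (Real.sqrt_nonneg _) (b1.trans (b2.trans ?_))
    -- `v` is `f'` minus its mean `m`, hence orthogonal to constants; thus `‖v‖² = ⟪v, f'⟫` and `‖v‖
    -- ≤ ‖f'‖`.
    have hI : ∫ s in Ioo 0 L, v s = 0 := by
      have := hV.2 L (right_mem_Icc.2 hL.le)
      rw [intervalIntegral.integral_of_le hL.le, integral_Ioc_eq_integral_Ioo] at this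
      rw [hVdef] at this
      simp only [hV0, hVL, zero_add] at this
      exact this.symm
    have hin : ⟪hv.toLp v, hv.toLp v⟫_ℂ = ⟪hv.toLp v, hf'.toLp f'⟫_ℂ := by
      have hcI : ∫ s in Ioo 0 L, m * starRingEnd ℂ (v s) = 0 := by
        rw [integral_const_mul, integral_conj, hI, map_zero, mul_zero]
      have i1 : IntegrableOn (fun s => f' s * starRingEnd ℂ (v s)) (Ioo 0 L) :=
        hf'.integrable_mul hv.star
      have i2 : IntegrableOn (fun s => m * starRingEnd ℂ (v s)) (Ioo 0 L) :=
        hv.star.integrableOn_Ioo.const_mul m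
      rw [inner_toLp_intervalMeasure, inner_toLp_intervalMeasure,
        ← sub_zero (∫ s in Ioo 0 L, f' s * _), ← hcI, ← integral_sub i1 i2]
      congr 1 with s
      rw [← sub_mul]
    rw [inner_self_eq_norm_sq_to_K] at hin
    have h1 := norm_inner_le_norm (𝕜 := ℂ) (hv.toLp v) (hf'.toLp f')
    rw [← hin, norm_pow] at h1
    simp only [Complex.coe_algebraMap, Complex.norm_real, norm_norm] at h1
    by_contra! h2
    nlinarith [norm_nonneg (hf'.toLp f')]
  · intro f'' hf'' hm''
    rw [← eLpNorm_congr_ae hR', ← eLpNorm_congr_ae hm''.coeFn_toLp]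
    -- `G - m` is a continuous version of `v` with derivative `f''`: the affine part contributes
    -- only a constant. `v` need not vanish at the ends, but the modes and `V` do.
    obtain ⟨G, hG, hGf⟩ := hf''.exists_isPrimitive hL hf'.integrableOn_Ioo hm''.integrableOn_Ioo
    have hGm : IsPrimitive L (fun s => G s - m) f'' :=
      ⟨hG.1, fun x hx => by beta_reduce; rw [hG.2 x hx]; ring⟩
    have hGv : (fun s => G s - m) =ᵐ[intervalMeasure L] v := hGf.mono fun s hs => by
      simp only [hvdef, hs]
    have key : ∀ W w : ℝ → ℂ, IsPrimitive L W w → W 0 = 0 → W L = 0 →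
        ∫ s in Ioo 0 L, v s * starRingEnd ℂ (w s) = -∫ s in Ioo 0 L, f'' s * starRingEnd ℂ (W s) :=
      fun W w hW h0 h1 => by
        rw [← hW.integral_mul_conj_eq_neg hL h0 h1 hGm]
        exact setIntegral_mul_conj_congr hGv.symm (ae_eq_refl _)
    refine eLpNorm_le_of_mul_norm_le (Real.sqrt_nonneg _) (b3 _ (fun i => ?_) ?_)
    · rw [inner_toLp_intervalMeasure, inner_toLp_intervalMeasure,
        key (X i) (d i) (hX i) (hX0 i) (hXL i), setIntegral_mul_conj_congr (ae_eq_refl f'') (hXae i)]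
    · rw [inner_toLp_intervalMeasure, inner_toLp_intervalMeasure, key V v hV hV0 hVL]

end InterfaceEdge.IsEdgeModes

end Residual

/-! ### Comparison of Sobolev and interpolation norms -/

theorem sobolevNorm_le_of_ae_eq {L : ℝ} {k : ℕ} {f f' : ℝ → ℂ} (h : f =ᵐ[intervalMeasure L] f') :
    sobolevNorm L k f ≤ sobolevNorm L k f' := by
  refine le_iInf₂ fun g hg => ?_
  have hae : ∀ i, Function.update g 0 f i =ᵐ[intervalMeasure L] g i := by
    intro i
    rcases eq_or_ne i 0 with rfl | hi
    · rw [Function.update_self, hg.1]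
      exact h
    · rw [Function.update_of_ne hi]
  have hch : IsWeakDerivChain L k f (Function.update g 0 f) :=
    ⟨Function.update_self _ _ _, fun i hi => (memLp_congr_ae (hae i)).2 (hg.2.1 i hi),
      fun i hi => (hg.2.2 i hi).congr (hae i).symm (hae (i + 1)).symm⟩
  refine (iInf₂_le _ hch).trans (le_of_eq ?_)
  simp only [fun i => eLpNorm_congr_ae (p := 2) (hae i)]

theorem mul_rpow_half_eq (c x : ℝ≥0∞) : c * x ^ (1 / 2 : ℝ) = (c ^ 2 * x) ^ (1 / 2 : ℝ) := by
  rw [ENNReal.mul_rpow_of_nonneg _ _ (by norm_num), ← ENNReal.rpow_natCast, ← ENNReal.rpow_mul]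
  norm_num

/-- The gain `c` is paid for by one derivative, so the orders are shifted by one and the term of
order zero on the right is discarded. -/
theorem mul_sobolevNorm_le_of_chain {L : ℝ} {k : ℕ} {F : ℝ → ℂ} {c : ℝ≥0∞}
    {G g : ℕ → ℝ → ℂ} (hG : IsWeakDerivChain L k F G)
    (h : ∀ i ≤ k, c * eLpNorm (G i) 2 (intervalMeasure L) ≤
      eLpNorm (g (i + 1)) 2 (intervalMeasure L)) :
    c * sobolevNorm L k F ≤
      (∑ i ∈ Finset.range (k + 1 + 1), eLpNorm (g i) 2 (intervalMeasure L) ^ 2) ^ (1 / 2 : ℝ) := by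
  refine (mul_le_mul_right (iInf₂_le G hG) c).trans ?_
  rw [mul_rpow_half_eq]
  refine ENNReal.rpow_le_rpow ?_ (by norm_num)
  rw [Finset.mul_sum, Finset.sum_range_succ' _ (k + 1)]
  refine le_add_right (Finset.sum_le_sum fun i hi => ?_)
  rw [← mul_pow]
  exact pow_le_pow_left' (h i (by simpa [Nat.lt_succ_iff] using hi)) 2

theorem exists_isPrimitive_of_sobolevNorm_lt_top {L : ℝ} (hL : 0 < L) {k : ℕ} {f : ℝ → ℂ}
    (h : sobolevNorm L (k + 1) f < ⊤) :
    ∃ F f', IsPrimitive L F f' ∧ F =ᵐ[intervalMeasure L] f := by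
  obtain ⟨g, rfl, hg, hw⟩ := exists_isWeakDerivChain_of_sobolevNorm_lt_top h
  obtain ⟨F, hF⟩ := (hw 0 (by omega)).exists_isPrimitive hL (hg 0 (by omega)).integrableOn_Ioo
    (hg 1 (by omega)).integrableOn_Ioo
  exact ⟨F, g 1, hF⟩

theorem mul_halfwayNorm_le {N₀ N₁ M₀ M₁ : (ℝ → ℂ) → ℝ≥0∞} {f g : ℝ → ℂ} {c : ℝ≥0∞} (hc : c ≠ ⊤)
    (h : ∀ t, 0 < t → c * kFunctional N₀ N₁ t f ≤ kFunctional M₀ M₁ t g) :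
    c * halfwayNorm N₀ N₁ f ≤ halfwayNorm M₀ M₁ g := by
  unfold halfwayNorm
  rw [mul_rpow_half_eq, ← lintegral_const_mul' _ _ (ENNReal.pow_ne_top hc)]
  refine ENNReal.rpow_le_rpow (setLIntegral_mono' measurableSet_Ioi fun t ht => ?_) (by norm_num)
  rw [← mul_assoc, ← mul_pow, mul_left_comm]
  gcongr
  exact h t ht

/-- Otherwise the integrand would be infinite on the whole half-line. A finite value supplies an
actual splitting into functions of finite norm. -/
theorem exists_kFunctional_lt_top {N₀ N₁ : (ℝ → ℂ) → ℝ≥0∞} {f : ℝ → ℂ}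
    (h : halfwayNorm N₀ N₁ f < ⊤) : ∃ t, 0 < t ∧ kFunctional N₀ N₁ t f < ⊤ := by
  by_contra! hK
  refine h.ne ?_
  unfold halfwayNorm
  have : ∀ t ∈ Ioi (0 : ℝ), (ENNReal.ofReal (t ^ (-(1 / 2) : ℝ)) * kFunctional N₀ N₁ t f) ^ 2 *
      ENNReal.ofReal t⁻¹ = ⊤ := by
    intro t ht
    have ht' : 0 < t := ht
    rw [top_le_iff.1 (hK t ht'),
      ENNReal.mul_top (by simpa using Real.rpow_pos_of_pos ht' _), ENNReal.top_pow two_ne_zero,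
      ENNReal.top_mul (by simpa using ht')]
  rw [setLIntegral_congr_fun measurableSet_Ioi this]
  simp

theorem modeResidual_sub {L : ℝ} {T : ℕ → ℝ → ℂ}
    (hT : ∀ i, 1 ≤ i → MemLp (T i) 2 (intervalMeasure L)) {f g : ℝ → ℂ}
    (hf : ContinuousOn f (Icc 0 L)) (hg : ContinuousOn g (Icc 0 L)) (n : ℕ) (s : ℝ) :
    modeResidual L T n (fun s => f s - g s) s = modeResidual L T n f s - modeResidual L T n g s := by
  have haff : ∀ r, affineInterpolant L (fun s => f s - g s) r =
      affineInterpolant L f r - affineInterpolant L g r := fun r => by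
    simp only [affineInterpolant]
    ring
  have hi : ∀ h : ℝ → ℂ, ContinuousOn h (Icc 0 L) → ∀ i, 1 ≤ i →
      IntegrableOn (fun r => (h r - affineInterpolant L h r) * starRingEnd ℂ (T i r)) (Ioo 0 L) := by
    intro h hh i hi
    have hc : ContinuousOn (fun r => h r - affineInterpolant L h r) (Icc 0 L) := by
      refine hh.sub (Continuous.continuousOn ?_)
      unfold affineInterpolant
      fun_prop
    exact (memLp_intervalMeasure_of_continuousOn hc).integrable_mul (hT i hi).star
  have hc : ∀ i, ∫ r in Ioo 0 L, (f r - g r - affineInterpolant L (fun s => f s - g s) r) *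
        starRingEnd ℂ (T (i + 1) r) =
      (∫ r in Ioo 0 L, (f r - affineInterpolant L f r) * starRingEnd ℂ (T (i + 1) r)) -
        ∫ r in Ioo 0 L, (g r - affineInterpolant L g r) * starRingEnd ℂ (T (i + 1) r) := by
    intro i
    rw [← integral_sub (hi f hf _ (by omega)) (hi g hg _ (by omega))]
    congr 1 with r
    rw [haff]
    ring
  simp only [modeResidual, hc]
  simp only [haff, sub_mul (_ : ℂ) _ (T _ s), Finset.sum_sub_distrib]
  ring

/-! ### Bounds for the residual, and continuous representatives -/

namespace InterfaceEdge

variable {e : InterfaceEdge} {τ : ℕ → EuclideanPlane → ℂ} {ev : ℕ → ℝ}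

theorem IsEdgeModes.mul_sobolevNorm_zero_modeResidual_le (h : e.IsEdgeModes τ ev) {n : ℕ}
    (hn : 1 ≤ n) {f F : ℝ → ℂ} (hF : ContinuousOn F (Icc 0 e.length))
    (hFf : F =ᵐ[intervalMeasure e.length] f) :
    ENNReal.ofReal √(ev n) *
        sobolevNorm e.length 0 (modeResidual e.length (fun i => τ i ∘ e.param) n F) ≤
      sobolevNorm e.length 1 f := by
  refine le_iInf₂ fun g hg => ?_
  obtain ⟨rfl, hm, hw⟩ := hg
  have hP := (hw 0 one_pos).isPrimitive_of_continuousOn e.length_pos (hm 0 (by omega)).integrableOn_Ioo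
    (hm 1 le_rfl).integrableOn_Ioo hF hFf
  obtain ⟨R', -, h2, -, h4, -⟩ := h.exists_modeResidual_deriv hn hP (hm 1 le_rfl)
  refine mul_sobolevNorm_le_of_chain (G := fun _ => modeResidual e.length _ n F)
    ⟨rfl, fun _ _ => h2, fun i hi => absurd hi (by omega)⟩ fun i hi => ?_
  obtain rfl : i = 0 := by omega
  exact h4

theorem IsEdgeModes.mul_sobolevNorm_one_modeResidual_le (h : e.IsEdgeModes τ ev) {n : ℕ}
    (hn : 1 ≤ n) {f F : ℝ → ℂ} (hF : ContinuousOn F (Icc 0 e.length))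
    (hFf : F =ᵐ[intervalMeasure e.length] f) :
    ENNReal.ofReal √(ev n) *
        sobolevNorm e.length 1 (modeResidual e.length (fun i => τ i ∘ e.param) n F) ≤
      sobolevNorm e.length 2 f := by
  refine le_iInf₂ fun g hg => ?_
  obtain ⟨rfl, hm, hw⟩ := hg
  have hP := (hw 0 two_pos).isPrimitive_of_continuousOn e.length_pos (hm 0 (by omega)).integrableOn_Ioo
    (hm 1 one_le_two).integrableOn_Ioo hF hFf
  obtain ⟨R', h1, h2, h3, h4, h5⟩ := h.exists_modeResidual_deriv hn hP (hm 1 one_le_two)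
  refine mul_sobolevNorm_le_of_chain (h1.isWeakDerivChain_one h2 h3) fun i hi => ?_
  rcases Nat.le_one_iff_eq_zero_or_eq_one.1 hi with rfl | rfl
  · exact h4
  · exact h5 _ (hw 1 one_lt_two) (hm 2 le_rfl)

/-- Each splitting `w = (w - f₁) + f₁` is carried by the linear residual operator to a splitting of
`r`, with both endpoint bounds gaining the same factor. -/
theorem IsEdgeModes.mul_kFunctional_le (h : e.IsEdgeModes τ ev) {n : ℕ} (hn : 1 ≤ n) {t : ℝ}
    (ht : 0 < t) {w r : ℝ → ℂ} (hw : ContinuousOn w (Icc 0 e.length))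
    (hr : r =ᵐ[intervalMeasure e.length] modeResidual e.length (fun i => τ i ∘ e.param) n w) :
    ENNReal.ofReal √(ev n) *
        kFunctional (sobolevNorm e.length 0) (sobolevNorm e.length 1) t r ≤
      kFunctional (sobolevNorm e.length 1) (sobolevNorm e.length 2) t w := by
  refine le_iInf fun f₁ => ?_
  rcases eq_or_ne (sobolevNorm e.length 2 f₁) ⊤ with htop | htop
  · rw [htop, ENNReal.mul_top (by simpa using ht), add_top]
    exact le_top
  -- The residual depends on end values, so `f₁` is replaced by its continuous representative.
  obtain ⟨F₁, f', hF₁, hF₁f⟩ :=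
    exists_isPrimitive_of_sobolevNorm_lt_top e.length_pos (lt_top_iff_ne_top.2 htop)
  have hc := hF₁.continuousOn e.length_pos
  have hae : (fun s => w s - F₁ s) =ᵐ[intervalMeasure e.length] w - f₁ :=
    hF₁f.mono fun s hs => by simp only [hs, Pi.sub_apply]
  have h0 := h.mul_sobolevNorm_zero_modeResidual_le hn (hw.sub hc) hae
  have h1 := h.mul_sobolevNorm_one_modeResidual_le hn hc hF₁f
  set R := modeResidual e.length (fun i => τ i ∘ e.param) n with hR
  have h2 : sobolevNorm e.length 0 (r - R F₁) ≤ sobolevNorm e.length 0 (R fun s => w s - F₁ s) := by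
    refine sobolevNorm_le_of_ae_eq ?_
    filter_upwards [hr] with s hs
    rw [Pi.sub_apply, hs, hR, modeResidual_sub (fun i hi => h.memLp hi) hw hc]
  calc ENNReal.ofReal √(ev n) * kFunctional (sobolevNorm e.length 0) (sobolevNorm e.length 1) t r
      ≤ ENNReal.ofReal √(ev n) * (sobolevNorm e.length 0 (r - R F₁) +
          ENNReal.ofReal t * sobolevNorm e.length 1 (R F₁)) := by
        gcongr
        exact iInf_le _ (R F₁)
    _ = ENNReal.ofReal √(ev n) * sobolevNorm e.length 0 (r - R F₁) +
          ENNReal.ofReal t * (ENNReal.ofReal √(ev n) * sobolevNorm e.length 1 (R F₁)) := by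
        ring
    _ ≤ _ := by
        gcongr
        exact (mul_le_mul_right h2 _).trans h0

/-- A finite K-functional splits `u` into an `H¹` and an `H²` part, each with a continuous
representative. -/
theorem exists_continuousOnClosure_of_normHThreeHalves_lt_top {u : EuclideanPlane → ℂ}
    (h : e.normHThreeHalves u < ⊤) : ∃ w, e.ContinuousOnClosure w ∧ e.AEEqual w u := by
  have hL := e.length_pos
  obtain ⟨t, ht, hK⟩ := exists_kFunctional_lt_top h
  obtain ⟨f₁, hf₁⟩ := iInf_lt_iff.1 hK
  obtain ⟨h0, h1⟩ := ENNReal.add_lt_top.1 hf₁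
  have h1' : sobolevNorm e.length 2 f₁ < ⊤ := by
    refine lt_top_iff_ne_top.2 fun htop => ?_
    rw [htop, ENNReal.mul_top (by simpa using ht)] at h1
    exact h1.ne rfl
  obtain ⟨F₀, _, hF₀, hF₀f⟩ := exists_isPrimitive_of_sobolevNorm_lt_top hL h0
  obtain ⟨F₁, _, hF₁, hF₁f⟩ := exists_isPrimitive_of_sobolevNorm_lt_top hL h1'
  refine ⟨e.extend fun s => F₀ s + F₁ s, ?_, ?_⟩
  · exact ((hF₀.continuousOn hL).add (hF₁.continuousOn hL)).congr fun s hs => e.extend_param _ hs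
  · refine (e.extend_comp_param_ae_eq _).trans ?_
    filter_upwards [hF₀f, hF₁f] with s h2 h3
    rw [h2, h3, Pi.sub_apply, Function.comp_apply, sub_add_cancel]

end InterfaceEdge

/-! ### The nodal interpolant on an edge, and the conclusion -/

/-- A function on an interval which is harmonic inside and continuous up to the end points is
affine. -/
theorem eq_affine_of_harmonicOnNhd {L : ℝ} (hL : 0 < L) {q : ℝ → ℝ}
    (hc : ContinuousOn q (Icc 0 L)) (hh : InnerProductSpace.HarmonicOnNhd q (Ioo 0 L)) {s : ℝ}
    (hs : s ∈ Icc 0 L) : q s = q 0 + s / L * (q L - q 0) := by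
  have hcd : ContDiffOn ℝ 2 q (Ioo 0 L) := hh.contDiffOn
  have hdiff : DifferentiableOn ℝ q (Ioo 0 L) := hcd.differentiableOn (by norm_num)
  have hdiff' : DifferentiableOn ℝ (deriv q) (Ioo 0 L) :=
    (hcd.deriv_of_isOpen isOpen_Ioo (m := 1) (by norm_num)).differentiableOn (by norm_num)
  have hz : ∀ x ∈ Ioo 0 L, deriv (deriv q) x = 0 := by
    intro x hx
    have := (hh x hx).2.self_of_nhds
    rw [InnerProductSpace.laplacian_eq_iteratedDeriv_real, iteratedDeriv_succ, iteratedDeriv_one] at this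
    exact this
  obtain ⟨k, hk⟩ := isOpen_Ioo.exists_is_const_of_deriv_eq_zero isPreconnected_Ioo hdiff' hz
  have hd1 : DifferentiableOn ℝ (fun x => q x - k * x) (Ioo 0 L) := by fun_prop
  obtain ⟨c, hc'⟩ := isOpen_Ioo.exists_is_const_of_deriv_eq_zero isPreconnected_Ioo hd1 (by
    intro x hx
    have h1 := (hdiff.differentiableAt (isOpen_Ioo.mem_nhds hx)).hasDerivAt
    have h2 := h1.sub ((hasDerivAt_id x).const_mul k)
    have h3 : deriv (fun x => q x - k * x) x = deriv q x - k * 1 := h2.deriv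
    rw [h3, hk x hx]
    simp)
  have hE : EqOn (fun x => q x - k * x) (fun _ => c) (Icc 0 L) := by
    refine EqOn.of_subset_closure (fun x hx => hc' x hx) (by fun_prop) continuousOn_const
      Ioo_subset_Icc_self ?_
    rw [closure_Ioo hL.ne]
  have e0 := hE (left_mem_Icc.2 hL.le)
  have e1 := hE (right_mem_Icc.2 hL.le)
  have e2 := hE hs
  simp only [mul_zero, sub_zero] at e0 e1 e2
  rw [e0, show q L = c + k * L by linarith]
  have e3 : q s = c + k * s := by linarith
  rw [e3]
  field_simp
  ring

/-- Every `φ p` is affine along the edge, so the interpolant is determined by its values at the two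
ends. These are vertices, where it reproduces `w`. -/
theorem DecompositionInterface.IsVertexBasis.nodalInterpolant_param {N : DecompositionInterface}
    {φ : EuclideanPlane → EuclideanPlane → ℝ} (hφ : N.IsVertexBasis φ) (k : Fin N.numEdges)
    (w : EuclideanPlane → ℂ) {s : ℝ} (hs : s ∈ Icc 0 (N.edge k).length) :
    N.nodalInterpolant φ w ((N.edge k).param s) =
      affineInterpolant (N.edge k).length (w ∘ (N.edge k).param) s := by
  set e := N.edge k
  have hsum : ∀ q ∈ N.vertices, ∑ p ∈ N.vertices, w p * (φ p q : ℂ) = w q := by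
    intro q hq
    rw [Finset.sum_eq_single_of_mem q hq fun p hp hpq => by rw [hφ.nodal p hp q hq, if_neg hpq]; simp,
      hφ.nodal q hq q hq]
    simp
  have haff : ∀ p ∈ N.vertices, w p * (φ p (e.param s) : ℂ) =
      w p * (φ p (e.param 0) : ℂ) + (s / e.length : ℝ) *
        (w p * (φ p (e.param e.length) : ℂ) - w p * (φ p (e.param 0) : ℂ)) := by
    intro p hp
    have := eq_affine_of_harmonicOnNhd e.length_pos (hφ.continuousOn p hp k) (hφ.harmonic p hp k) hs
    simp only [Function.comp] at this
    rw [this]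
    push_cast
    ring
  rw [DecompositionInterface.nodalInterpolant, Finset.sum_congr rfl haff, Finset.sum_add_distrib,
    ← Finset.mul_sum, Finset.sum_sub_distrib, hsum _ (N.start_mem k), hsum _ (N.end_mem k)]
  rfl

theorem mainTheorem7 (N : DecompositionInterface) (k : Fin N.numEdges) :
    ∃ C : ℝ, 0 < C ∧
      ∀ (φ : EuclideanPlane → EuclideanPlane → ℝ), N.IsVertexBasis φ →
      ∀ (τ : ℕ → EuclideanPlane → ℂ) (ev : ℕ → ℝ), (N.edge k).IsEdgeModes τ ev →
      ∀ u : EuclideanPlane → ℂ, (N.edge k).normHThreeHalves u < ⊤ →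
        (∃ w, (N.edge k).ContinuousOnClosure w ∧ (N.edge k).AEEqual w u) ∧
        ∀ w, (N.edge k).ContinuousOnClosure w → (N.edge k).AEEqual w u →
        ∀ n : ℕ, 1 ≤ n →
          ⨅ v ∈ modeSpace τ n,
              (N.edge k).normHHalf (fun x => w x - N.nodalInterpolant φ w x - v x) ≤
            ENNReal.ofReal (C / √(ev n)) * (N.edge k).normHThreeHalves w := by
  refine ⟨1, one_pos, fun φ hφ τ ev h u hu =>
    ⟨InterfaceEdge.exists_continuousOnClosure_of_normHThreeHalves_lt_top hu,
      fun w hw _ n hn => ?_⟩⟩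
  set e := N.edge k with he
  set c : ℕ → ℂ := fun i => ∫ r in Ioo 0 e.length, ((w ∘ e.param) r -
    affineInterpolant e.length (w ∘ e.param) r) * starRingEnd ℂ (τ (i + 1) (e.param r)) with hc
  -- The competitor: the `L²` projection of `w` minus its interpolant onto the first `n` modes, with
  -- the index shifted because modes are numbered from one.
  have hv : ∑ i ∈ Finset.range n, c i • τ (i + 1) ∈ modeSpace τ n :=
    Submodule.sum_mem _ fun i hi => Submodule.smul_mem _ _ (Submodule.subset_span
      ⟨i + 1, ⟨by omega, by simpa [Nat.succ_le_iff] using hi⟩, rfl⟩)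
  refine (iInf₂_le _ hv).trans ?_
  have hpos := Real.sqrt_pos.2 (h.ev_pos hn)
  have hae : (fun x => w x - N.nodalInterpolant φ w x - (∑ i ∈ Finset.range n, c i • τ (i + 1)) x) ∘
      e.param =ᵐ[intervalMeasure e.length]
        modeResidual e.length (fun i => τ i ∘ e.param) n (w ∘ e.param) := by
    refine (ae_restrict_mem measurableSet_Ioo).mono fun s hs => ?_
    simp only [Function.comp, he, hφ.nodalInterpolant_param k w (Ioo_subset_Icc_self hs)]
    simp only [modeResidual, Finset.sum_apply, Pi.smul_apply, smul_eq_mul]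
    rfl
  have key := mul_halfwayNorm_le ENNReal.ofReal_ne_top fun t ht => h.mul_kFunctional_le hn ht hw hae
  rw [one_div, ENNReal.ofReal_inv_of_pos hpos, mul_comm, ← div_eq_mul_inv,
    ENNReal.le_div_iff_mul_le (Or.inl (by simpa using hpos)) (Or.inl ENNReal.ofReal_ne_top), mul_comm]
  exact key
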